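/- **Setting.** There are $L$ base arms and a nonempty action set $\mathcal A\subseteq 2^{[L]}$ whose members (batches) satisfy $|A|\le K$, where $K\ge 2$. There are weights $w_1,\dots,w_M\ge 0$ and functions $r_i(A;x)\ge 0$ ($i\in[M]$, $A\in\mathcal A$, $x\in[0,1]^L$). In every round $t=1,2,\dots$ a feedback matrix $X(t)=(X_{ij}(t))\in[0,1]^{M\times L}$ is drawn from a fixed distribution (its entries may be arbitrarily correlated), with means $p_{ij}=\mathbb E[X_{ij}(t)]$, independently of the past and of the batch $A_t\in\mathcal A$ played in round $t$; $X_{ij}(t)$ is observed for $j\in A_t$. The reward of $A$ at parameters $x\in[0,1]^{M\times L}$ is $r(A;x)=\sum_{i=1}^M w_i r_i(A;x_i)$, with $x_i$ the $i$-th row of $x$. Each $r_i$ is *monotonic Gini-smooth* with parameters $\gamma_\infty,\gamma_g$: for every $A\in\mathcal A$, $r_i(A;\cdot)$ is continuous on $[0,1]^L$ and differentiable on $(0,1)^L$, and for all $x\in(0,1)^L$, $0\le\frac{\partial r_i(A;x)}{\partial x_j}\le\gamma_\infty$ if $j\in A$, $\frac{\partial r_i(A;x)}{\partial x_j}=0$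 if $j\notin A$, and $\sqrt{\sum_{j=1}^L x_j(1-x_j)\big(\frac{\partial r_i(A;x)}{\partial x_j}\big)^2}\le\gamma_g$. Let $\alpha,\beta\in[0,1]$. An $(\alpha,\beta)$-approximation oracle is a randomized map that for every $x\in[0,1]^{M\times L}$ outputs some $A\in\mathcal A$ with $\Pr\big[r(A;x)\ge\alpha\max_{A'\in\mathcal A}r(A';x)\big]\ge\beta$. **Algorithm (BC-UCB).** Let $N_j(t)$ be the number of rounds $\tau\le t$ with $j\in A_\tau$, and let $\hat p_{ij}(t)$ and $\hat V_{ij}(t)$ be the empirical mean and the empirical variance (with normalization $1/N_j(t)$) of $X_{ij}(\tau)$ over these rounds. In round $t$, if $N_j(t-1)=0$ for some $j$, a batch $A_t$ is played that contains such an arm. Otherwise $A_t$ is the output of the oracle at $$q_{ij}(t)=\min\Big\{1,\ \hat p_{ij}(t-1)+\sqrt{\tfrac{6\hat V_{ij}(t-1)\log t}{N_j(t-1)}}+\tfrac{9\log t}{N_j(t-1)}\Big\}.$$ **Claim.** Put $r_{\max}=\max_{A\in\mathcal A}r(A;p)$, $\Delta_A=\alpha r_{\max}-r(A;p)$, $\Delta_{\max}=\max_{A\in\mathcal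 A}\max\{\Delta_A,0\}$ (the largest positive gap, or $0$ if there is none), $\bar M=\sum_{i=1}^M w_i$ and, for $T\ge1$, $$R(T)=\alpha\beta r_{\max}T-\sum_{t=1}^T\mathbb E[r(A_t;p)],\qquad x_T=340\,\gamma_\infty\bar M L\Big\lceil\frac{\log K}{1.61}\Big\rceil^2\log T .$$ Then for every $T\ge 1$ the regret of BC-UCB with an $(\alpha,\beta)$-approximation oracle satisfies $$R(T)\le 2\sqrt{8640}\,\gamma_g\bar M\Big\lceil\frac{\log K}{1.61}\Big\rceil\sqrt{LT\log T}+L\Delta_{\max}\Big(1+\frac{2\pi^2}{3}M\Big)+x_T\cdot\max\Big\{1,\ 2+\log\frac{\Delta_{\max}T}{x_T}\Big\},$$ where the last term is read as $0$ if $x_T=0$, and $\log 0$ is read as $0$ if $\Delta_{\max}=0<x_T$. -/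

import Mathlib

open MeasureTheory ProbabilityTheory

noncomputable section

namespace CombBandit

/-- The open unit cube `(0,1)^L`. -/
def openCube (L : ℕ) : Set (Fin L → ℝ) := {x | ∀ j, 0 < x j ∧ x j < 1}

/-- The closed unit cube `[0,1]^L`. -/
def closedCube (L : ℕ) : Set (Fin L → ℝ) := {x | ∀ j, 0 ≤ x j ∧ x j ≤ 1}

/-- The partial derivative of `g` in the coordinate `j` at `x`. -/
def partialDeriv {L : ℕ} (g : (Fin L → ℝ) → ℝ) (j : Fin L) (x : Fin L → ℝ) : ℝ :=
  fderiv ℝ g x (Pi.single j 1)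

/-- `f(A; x)` is monotonic Gini-smooth over the action set `𝒜`, with smoothness parameters
`γinf` and `γg`. -/
structure IsMonotonicGiniSmooth {L : ℕ} (𝒜 : Finset (Finset (Fin L)))
    (f : Finset (Fin L) → (Fin L → ℝ) → ℝ) (γinf γg : ℝ) : Prop where
  differentiableOn : ∀ A ∈ 𝒜, DifferentiableOn ℝ (f A) (openCube L)
  continuousOn : ∀ A ∈ 𝒜, ContinuousOn (f A) (closedCube L)
  deriv_mem : ∀ A ∈ 𝒜, ∀ x ∈ openCube L, ∀ j ∈ A,
    0 ≤ partialDeriv (f A) j x ∧ partialDeriv (f A) j x ≤ γinf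
  deriv_eq_zero : ∀ A ∈ 𝒜, ∀ x ∈ openCube L, ∀ j, j ∉ A → partialDeriv (f A) j x = 0
  gini_le : ∀ A ∈ 𝒜, ∀ x ∈ openCube L,
    √(∑ j, x j * (1 - x j) * (partialDeriv (f A) j x) ^ 2) ≤ γg

/-- An instance of the stochastic combinatorial semi-bandit problem with `L` base arms, whose
reward is a weighted sum of `M` nonnegative functions. In one round the feedback is a random
element of `[0,1]^{M × L}` of distribution `law`; its entries may be arbitrarily correlated. -/
structure Problem (L M : ℕ) where
  /-- the action set, a nonempty collection of batches of base arms -/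
  actions : Finset (Finset (Fin L))
  actions_nonempty : actions.Nonempty
  /-- the weights `w_i` -/
  weight : Fin M → ℝ
  weight_nonneg : ∀ i, 0 ≤ weight i
  /-- the functions `r_i(A; x)` -/
  rewardFn : Fin M → Finset (Fin L) → (Fin L → ℝ) → ℝ
  rewardFn_nonneg : ∀ i, ∀ A ∈ actions, ∀ x ∈ closedCube L, 0 ≤ rewardFn i A x
  /-- the distribution of the feedback matrix of a single round -/
  law : Measure (Fin M → Fin L → ℝ)
  law_isProbabilityMeasure : IsProbabilityMeasure law
  law_mem : ∀ᵐ x ∂law, ∀ i, x i ∈ closedCube L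

namespace Problem

variable {L M : ℕ} (P : Problem L M)

/-- The arm parameters `p_{ij}`: the means of the feedback. -/
def mean : Fin M → Fin L → ℝ := fun i j => ∫ x, x i j ∂P.law

/-- The reward `r(A; x) = ∑ i, w_i r_i(A; x_i)`. -/
def reward (A : Finset (Fin L)) (x : Fin M → Fin L → ℝ) : ℝ :=
  ∑ i, P.weight i * P.rewardFn i A (x i)

/-- The optimal value `max_{A ∈ 𝒜} r(A; x)` for the parameters `x`. -/
def optValue (x : Fin M → Fin L → ℝ) : ℝ :=
  P.actions.sup' P.actions_nonempty fun A => P.reward A x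

/-- The sum of the weights. -/
def totalWeight : ℝ := ∑ i, P.weight i

/-- The suboptimality gap `α r_max - r(A; p)` of a batch. -/
def gap (α : ℝ) (A : Finset (Fin L)) : ℝ := α * P.optValue P.mean - P.reward A P.mean

/-- The maximal gap: the largest positive gap of a batch, and `0` if no gap is positive. -/
def maxGap (α : ℝ) : ℝ := P.actions.sup' P.actions_nonempty fun A => max (P.gap α A) 0

/-- A randomized map from parameters to batches is an `(α, β)`-approximation oracle if, for every
parameter set, it outputs an action, and its value is at least `α` times the optimal value with
probability at least `β`. -/
def IsApproxOracle (oracle : (Fin M → Fin L → ℝ) → PMF (Finset (Fin L))) (α β : ℝ) : Prop :=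
  ∀ x : Fin M → Fin L → ℝ, (∀ i, x i ∈ closedCube L) →
    (∀ A ∈ (oracle x).support, A ∈ P.actions) ∧
    ENNReal.ofReal β ≤
      (oracle x).toOuterMeasure {A | A ∈ P.actions ∧ α * P.optValue x ≤ P.reward A x}

end Problem

section Algorithm

variable {L M : ℕ} {Ω : Type*}

/-! Rounds are numbered `1, 2, …`. `X t ω i j` is the feedback of arm `j` for the function `i`
in round `t`, and `A t ω` is the batch played in round `t`. The estimators use the feedback of
an arm only in the rounds in which it is played. -/

/-- `N_j(t)`: the number of times the arm `j` was played in the rounds `1, …, t`. -/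
def count (A : ℕ → Ω → Finset (Fin L)) (t : ℕ) (j : Fin L) (ω : Ω) : ℕ :=
  ((Finset.Icc 1 t).filter fun τ => j ∈ A τ ω).card

/-- The empirical mean of the feedback of arm `j` after `t` rounds. -/
def empMean (X : ℕ → Ω → Fin M → Fin L → ℝ) (A : ℕ → Ω → Finset (Fin L))
    (t : ℕ) (i : Fin M) (j : Fin L) (ω : Ω) : ℝ :=
  (∑ τ ∈ (Finset.Icc 1 t).filter (fun τ => j ∈ A τ ω), X τ ω i j) / count A t j ω

/-- The empirical variance of the feedback of arm `j` after `t` rounds. -/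
def empVar (X : ℕ → Ω → Fin M → Fin L → ℝ) (A : ℕ → Ω → Finset (Fin L))
    (t : ℕ) (i : Fin M) (j : Fin L) (ω : Ω) : ℝ :=
  (∑ τ ∈ (Finset.Icc 1 t).filter (fun τ => j ∈ A τ ω), (X τ ω i j) ^ 2) / count A t j ω
    - (empMean X A t i j ω) ^ 2

/-- The index `q_{ij}(t + 1)`, computed from the first `t` rounds. -/
def ucbIndex (X : ℕ → Ω → Fin M → Fin L → ℝ) (A : ℕ → Ω → Finset (Fin L))
    (t : ℕ) (ω : Ω) : Fin M → Fin L → ℝ := fun i j =>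
  min 1 (empMean X A t i j ω
    + √(6 * empVar X A t i j ω * Real.log ((t + 1 : ℕ) : ℝ) / count A t j ω)
    + 9 * Real.log ((t + 1 : ℕ) : ℝ) / count A t j ω)

/-- The history of the first `t` rounds: the `σ`-algebra of their feedback and batches. -/
@[reducible] def history (X : ℕ → Ω → Fin M → Fin L → ℝ) (A : ℕ → Ω → Finset (Fin L)) (t : ℕ) :
    MeasurableSpace Ω :=
  ⨆ τ ∈ Finset.Icc 1 t,
    MeasurableSpace.comap (X τ) inferInstance ⊔ MeasurableSpace.comap (A τ) ⊤

/-- `X` and `A` are the feedback and the batches of a run of BC-UCB with the given oracle on the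
problem `P` during the rounds `1, …, T`. -/
structure IsBCUCBRun [MeasurableSpace Ω] (μ : Measure Ω) (P : Problem L M)
    (oracle : (Fin M → Fin L → ℝ) → PMF (Finset (Fin L))) (T : ℕ)
    (X : ℕ → Ω → Fin M → Fin L → ℝ) (A : ℕ → Ω → Finset (Fin L)) : Prop where
  measurable_feedback : ∀ t < T, Measurable (X (t + 1))
  measurable_batch : ∀ t < T, ∀ B, MeasurableSet {ω | A (t + 1) ω = B}
  /-- in each round the feedback matrix is drawn from `P.law` … -/
  feedback_law : ∀ t < T, μ.map (X (t + 1)) = P.law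
  /-- … independently of the past and of the batch that is played in this round -/
  feedback_indep : ∀ t < T, Indep (MeasurableSpace.comap (X (t + 1)) inferInstance)
    (history X A t ⊔ MeasurableSpace.comap (A (t + 1)) ⊤) μ
  batch_mem : ∀ t < T, ∀ᵐ ω ∂μ, A (t + 1) ω ∈ P.actions
  /-- while there are arms that were never played, the batch contains such an arm -/
  init_round : ∀ t < T, ∀ᵐ ω ∂μ, (∃ j, count A t j ω = 0) →
    ∃ j, count A t j ω = 0 ∧ j ∈ A (t + 1) ω
  /-- afterwards, given the past, the batch is an output of the oracle at the index `q(t + 1)` -/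
  oracle_round : ∀ t < T, ∀ B, ∀ᵐ ω ∂μ, (∀ j, count A t j ω ≠ 0) →
    (μ⟦{ω' | A (t + 1) ω' = B} | history X A t⟧) ω = (oracle (ucbIndex X A t ω) B).toReal

/-- The expected approximation regret
`R(T) = α β r_max T - ∑_{t=1}^T E[r(A_t; p)]`. -/
def regret [MeasurableSpace Ω] (μ : Measure Ω) (P : Problem L M) (α β : ℝ)
    (A : ℕ → Ω → Finset (Fin L)) (T : ℕ) : ℝ :=
  α * β * P.optValue P.mean * T - ∑ t ∈ Finset.Icc 1 T, ∫ ω, P.reward (A t ω) P.mean ∂μ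

end Algorithm

/-- `⌈log K / 1.61⌉`. -/
def logFactor (K : ℕ) : ℝ := ((⌈Real.log K / 1.61⌉ : ℤ) : ℝ)

end CombBandit

end

namespace CombBandit

/-! ### Bounds for the exponential function -/

/-! The substitution x_j = sin² θ_j turns Gini-smoothness into Lipschitz continuity: since x_j(1 -
x_j) = (sin θ_j cos θ_j)², the gradient of each r_i(A; ·) in the angles has Euclidean norm at most
2γg. A Bernstein-type error q - p ≤ 5√(p(1-p))u + 18u² moves the angle by at most 12u, whatever p is
(`angle_sub_le`). So if in round t every index exceeds its mean by at most such an error with u_j² =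
log t / N_j, and the oracle succeeds, then optimism bounds the gap of the batch by 24 γg W √(log t ·
∑_{j ∈ A_t} 1/N_j), where W is the total weight (`mono_and_sub_le`, `gap_le_of_index`).

The indices are good with high probability. For a fixed number s of plays, an exponential
supermartingale over the plays of an arm gives Bernstein bounds for the empirical mean and for the
second moment about the true mean, each failing with probability at most t⁻³
(`lintegral_prod_le_one`, `measure_bernstein`, `measure_lower_tail`). A union bound over s leaves
3t⁻² per entry (`measure_not_isGoodIndex_le`).

The goodness of the indices is an event of the history, so on it the oracle still succeeds with
conditional probability at least β (`oracle_success`). This is why the benchmark αβ r_max can be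
charged only to the rounds in which the oracle succeeds (`round_regret_le`).

Along each sample path, the radii √(∑ 1/N_j) sum to at most (3 + √(1 + log K))√(LT)
(`sum_sqrt_sum_inv_count_le`). Small, medium and large counters are treated separately; the batch
size enters only through the medium range, hence only logarithmically.

This gives the √T term and a constant term, each within the one claimed. The summand with γinf is
nonnegative and is not needed. -/

lemma exp_neg_le_quadratic {x : ℝ} (hx : 0 ≤ x) : Real.exp (-x) ≤ 1 - x + x ^ 2 / 2 := by
  have hd : ∀ y : ℝ, HasDerivAt (fun y : ℝ => 1 - y + y ^ 2 / 2 - Real.exp (-y))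
      (-1 + y + Real.exp (-y)) y := by
    intro y
    have h1 := ((hasDerivAt_id y).neg).exp
    have h2 := ((hasDerivAt_id y).pow 2).div_const 2
    have h3 := (((hasDerivAt_id y).const_sub 1).add h2).sub h1
    refine (h3.congr_deriv ?_)
    simp
  have hm : MonotoneOn (fun y : ℝ => 1 - y + y ^ 2 / 2 - Real.exp (-y)) (Set.Ici 0) := by
    refine monotoneOn_of_deriv_nonneg (convex_Ici 0)
      (fun y _ => (hd y).continuousAt.continuousWithinAt)
      (fun y _ => (hd y).differentiableAt.differentiableWithinAt) fun y _ => ?_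
    rw [(hd y).deriv]
    linarith [Real.add_one_le_exp (-y)]
  have := hm (Set.mem_Ici.2 le_rfl) (Set.mem_Ici.2 hx) hx
  simp at this
  linarith

/-- After multiplication by e^{-x}(1 - x/3), the claim is that e^{-x}(1 + 2x/3 + x²/6) + x/3 is at
least its value 1 at 0. Its derivative is (1 - e^{-x}(1 + x + x²/2))/3, which is nonnegative. -/
lemma exp_le_of_nonneg_of_lt_three {x : ℝ} (hx : 0 ≤ x) (hx3 : x < 3) :
    Real.exp x ≤ 1 + x + x ^ 2 / (2 * (1 - x / 3)) := by
  have hd : ∀ y : ℝ, HasDerivAt (fun y : ℝ => Real.exp (-y) * (1 + 2 * y / 3 + y ^ 2 / 6) + y / 3)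
      (1 / 3 * (1 - Real.exp (-y) * (1 + y + y ^ 2 / 2))) y := by
    intro y
    have h1 := ((hasDerivAt_id y).neg).exp
    have h2 := ((hasDerivAt_id y).pow 2).div_const 6
    have h3 := (((hasDerivAt_id y).const_mul 2).div_const 3).const_add 1
    have h4 := (h1.mul (h3.add h2)).add ((hasDerivAt_id y).div_const 3)
    refine (h4.congr_deriv ?_)
    simp
    ring
  have hm : MonotoneOn (fun y : ℝ => Real.exp (-y) * (1 + 2 * y / 3 + y ^ 2 / 6) + y / 3)
      (Set.Ici 0) := by
    refine monotoneOn_of_deriv_nonneg (convex_Ici 0)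
      (fun y _ => (hd y).continuousAt.continuousWithinAt)
      (fun y _ => (hd y).differentiableAt.differentiableWithinAt) fun y hy => ?_
    rw [(hd y).deriv]
    have hy0 : 0 ≤ y := by
      rw [interior_Ici] at hy
      exact (Set.mem_Ioi.1 hy).le
    have h1 := mul_le_mul_of_nonneg_left (Real.quadratic_le_exp_of_nonneg hy0)
      (Real.exp_pos (-y)).le
    rw [← Real.exp_add, neg_add_cancel, Real.exp_zero] at h1
    linarith
  have h := hm (Set.mem_Ici.2 le_rfl) (Set.mem_Ici.2 hx) hx
  simp at h
  have hpos : 0 < 1 - x / 3 := by linarith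
  have h5 : Real.exp x * (1 - x / 3) ≤ 1 + 2 * x / 3 + x ^ 2 / 6 := by
    have h6 := mul_le_mul_of_nonneg_left h (Real.exp_pos x).le
    have h7 : Real.exp x * Real.exp (-x) = 1 := by
      rw [← Real.exp_add, add_neg_cancel, Real.exp_zero]
    have h8 : Real.exp x * (Real.exp (-x) * (1 + 2 * x / 3 + x ^ 2 / 6) + x / 3)
        = (Real.exp x * Real.exp (-x)) * (1 + 2 * x / 3 + x ^ 2 / 6) + Real.exp x * (x / 3) := by
      ring
    rw [h8, h7] at h6
    linarith
  have h9 : 1 + x + x ^ 2 / (2 * (1 - x / 3)) = (1 + 2 * x / 3 + x ^ 2 / 6) / (1 - x / 3) := by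
    rw [eq_div_iff hpos.ne', add_mul, div_mul_eq_mul_div, mul_div_mul_right _ _ hpos.ne']
    ring
  rw [h9, le_div_iff₀ hpos]
  exact h5

lemma exp_le_of_le_of_lt_three {x y : ℝ} (hx : 0 ≤ x) (hx3 : x < 3) (hy : y ≤ x) :
    Real.exp y ≤ 1 + y + y ^ 2 / (2 * (1 - x / 3)) := by
  have hpos : 0 < 1 - x / 3 := by linarith
  rcases le_total 0 y with h0 | h0
  · refine (exp_le_of_nonneg_of_lt_three h0 (by linarith)).trans ?_
    gcongr
  · have h1 := exp_neg_le_quadratic (neg_nonneg.2 h0)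
    rw [neg_neg] at h1
    have h2 : y ^ 2 / 2 ≤ y ^ 2 / (2 * (1 - x / 3)) := by
      gcongr
      linarith
    nlinarith

/-! ### Angles -/

lemma sin_sq_mem_Icc (x : ℝ) : 0 ≤ Real.sin x ^ 2 ∧ Real.sin x ^ 2 ≤ 1 :=
  ⟨sq_nonneg _, Real.sin_sq_le_one x⟩

/-- A Bernstein-type deviation is a deviation of order `u` of the angles. -/
lemma angle_sub_le {φ ψ u : ℝ} (hφ : 0 ≤ φ) (hφψ : φ ≤ ψ) (hψ : ψ ≤ Real.pi / 2) (hu : 0 ≤ u)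
    (h : Real.sin ψ ^ 2 - Real.sin φ ^ 2
      ≤ 5 * √(Real.sin φ ^ 2 * (1 - Real.sin φ ^ 2)) * u + 18 * u ^ 2) :
    ψ - φ ≤ 12 * u := by
  have hpi := Real.pi_pos
  set D := Real.sin (ψ - φ) with hD
  set S := Real.sin (ψ + φ) with hS
  have hprod : Real.sin ψ ^ 2 - Real.sin φ ^ 2 = D * S := by
    rw [hD, hS, Real.sin_sub, Real.sin_add]
    have h1 := Real.sin_sq_add_cos_sq ψ
    have h2 := Real.sin_sq_add_cos_sq φ
    linear_combination (Real.sin φ) ^ 2 * h1 - (Real.sin ψ) ^ 2 * h2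
  have hD0 : 0 ≤ D := Real.sin_nonneg_of_nonneg_of_le_pi (by linarith) (by linarith)
  have hDS : D ≤ S := by
    rcases le_total (ψ + φ) (Real.pi / 2) with hc | hc
    · exact Real.sin_le_sin_of_le_of_le_pi_div_two (by linarith) hc (by linarith)
    · rw [hS, ← Real.sin_pi_sub]
      exact Real.sin_le_sin_of_le_of_le_pi_div_two (by linarith) (by linarith) (by linarith)
  have hroot : √(Real.sin φ ^ 2 * (1 - Real.sin φ ^ 2)) = Real.sin φ * Real.cos φ := by
    rw [← Real.cos_sq', ← mul_pow, Real.sqrt_sq]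
    exact mul_nonneg (Real.sin_nonneg_of_nonneg_of_le_pi hφ (by linarith))
      (Real.cos_nonneg_of_neg_pi_div_two_le_of_le (by linarith) (by linarith))
  -- Half of sin 2φ, expanded with 2φ = (ψ + φ) - (ψ - φ), is at most (S + D)/2 ≤ S.
  have hdouble : Real.sin φ * Real.cos φ ≤ S := by
    have h1 : 2 * (Real.sin φ * Real.cos φ) = S * Real.cos (ψ - φ) - Real.cos (ψ + φ) * D := by
      rw [hD, hS, ← Real.sin_sub, ← mul_assoc, ← Real.sin_two_mul]
      congr 1
      ring
    have hS0 : 0 ≤ S := hD0.trans hDS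
    have h2 : S * Real.cos (ψ - φ) ≤ S := mul_le_of_le_one_right hS0 (Real.cos_le_one _)
    have h3 : -Real.cos (ψ + φ) * D ≤ D :=
      mul_le_of_le_one_left hD0 (by linarith [Real.neg_one_le_cos (ψ + φ)])
    linarith
  rw [hprod, hroot] at h
  -- Otherwise D(D - 5u) would exceed (15/2)(5/2)u² = 18.75u², while D ≤ S bounds it by 18u².
  have hDu : D ≤ 15 / 2 * u := by
    by_contra hc
    push Not at hc
    have h1 : 5 * (Real.sin φ * Real.cos φ) * u ≤ 5 * S * u := by gcongr
    have h2 : S * (D - 5 * u) ≤ 18 * u ^ 2 := by linarith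
    have h3 : D * (D - 5 * u) ≤ S * (D - 5 * u) :=
      mul_le_mul_of_nonneg_right hDS (by linarith)
    nlinarith
  -- Jordan's inequality returns from the sine to the angle at the cost of π/2, and (π/2)(15/2) <
  -- 12.
  have hj := Real.mul_le_sin (x := ψ - φ) (by linarith) (by linarith)
  have h5 : 2 / Real.pi * (ψ - φ) ≤ 15 / 2 * u := hj.trans hDu
  rw [div_mul_eq_mul_div, div_le_iff₀ hpi] at h5
  have h6 : Real.pi * u ≤ 3.15 * u := mul_le_mul_of_nonneg_right Real.pi_lt_d2.le hu
  linarith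

/-! ### Gini-smooth functions along paths of angles -/

lemma sin_sq_mem_openCube {L : ℕ} {θ : Fin L → ℝ} (h : ∀ j, 0 < θ j ∧ θ j < Real.pi / 2) :
    (fun j => Real.sin (θ j) ^ 2) ∈ openCube L := by
  intro j
  have h1 : 0 < Real.sin (θ j) :=
    Real.sin_pos_of_pos_of_lt_pi (h j).1 (by linarith [(h j).2, Real.pi_pos])
  have h2 : Real.sin (θ j) < 1 := by
    rw [← Real.sin_pi_div_two]
    exact Real.sin_lt_sin_of_lt_of_le_pi_div_two (by linarith [(h j).1, Real.pi_pos]) le_rfl (h j).2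
  exact ⟨by positivity, by nlinarith⟩

lemma openCube_eq_pi (L : ℕ) : openCube L = Set.univ.pi fun _ => Set.Ioo (0 : ℝ) 1 := by
  ext x
  simp [openCube]

lemma isOpen_openCube (L : ℕ) : IsOpen (openCube L) := by
  rw [openCube_eq_pi]
  exact isOpen_set_pi Set.finite_univ fun _ _ => isOpen_Ioo

namespace IsMonotonicGiniSmooth

variable {L : ℕ} {𝒜 : Finset (Finset (Fin L))} {f : Finset (Fin L) → (Fin L → ℝ) → ℝ} {γinf γg : ℝ}

/-- Mean value theorem along the straight segment in the angles, not in the parameters; the factor 2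
sin θ cos θ is the derivative of sin². -/
lemma exists_sub_eq (hf : IsMonotonicGiniSmooth 𝒜 f γinf γg) {A : Finset (Fin L)} (hA : A ∈ 𝒜)
    {φ ψ : Fin L → ℝ} (hφ : ∀ j, 0 < φ j ∧ φ j < Real.pi / 2)
    (hψ : ∀ j, 0 < ψ j ∧ ψ j < Real.pi / 2) :
    ∃ θ : Fin L → ℝ, (∀ j, 0 < θ j ∧ θ j < Real.pi / 2) ∧
      f A (fun j => Real.sin (ψ j) ^ 2) - f A (fun j => Real.sin (φ j) ^ 2)
        = ∑ j ∈ A, partialDeriv (f A) j (fun j => Real.sin (θ j) ^ 2) *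
          (2 * Real.sin (θ j) * Real.cos (θ j) * (ψ j - φ j)) := by
  set θ : ℝ → Fin L → ℝ := fun s j => φ j + s * (ψ j - φ j) with hθ
  have hθmem : ∀ s ∈ Set.Icc (0 : ℝ) 1, ∀ j, 0 < θ s j ∧ θ s j < Real.pi / 2 := by
    intro s hs j
    have h := (convex_Ioo (0 : ℝ) (Real.pi / 2)).add_smul_sub_mem (hφ j) (hψ j) hs
    simpa [hθ] using h
  set x : ℝ → Fin L → ℝ := fun s j => Real.sin (θ s j) ^ 2 with hx
  have hxd : ∀ s, HasDerivAt x
      (fun j => 2 * Real.sin (θ s j) * Real.cos (θ s j) * (ψ j - φ j)) s := by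
    intro s
    rw [hasDerivAt_pi]
    intro j
    have h1 : HasDerivAt (fun s => θ s j) (ψ j - φ j) s := by
      have := ((hasDerivAt_id s).mul_const (ψ j - φ j)).const_add (φ j)
      simpa [hθ] using this
    have h2 := h1.sin.pow 2
    refine h2.congr_deriv ?_
    simp
    ring
  have hFd : ∀ s ∈ Set.Icc (0 : ℝ) 1, HasDerivAt (fun s => f A (x s))
      (∑ j ∈ A, partialDeriv (f A) j (x s) *
          (2 * Real.sin (θ s j) * Real.cos (θ s j) * (ψ j - φ j))) s := by
    intro s hs
    have hmem := sin_sq_mem_openCube (hθmem s hs)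
    have hdiff : DifferentiableAt ℝ (f A) (x s) :=
      (hf.differentiableOn A hA).differentiableAt ((isOpen_openCube L).mem_nhds hmem)
    have h := hdiff.hasFDerivAt.comp_hasDerivAt s (hxd s)
    refine h.congr_deriv ?_
    conv_lhs => rw [pi_eq_sum_univ' (fun j => 2 * Real.sin (θ s j) * Real.cos (θ s j) * (ψ j - φ j))]
    rw [map_sum]
    rw [← Finset.sum_subset (Finset.subset_univ A)]
    · refine Finset.sum_congr rfl fun j _ => ?_
      rw [map_smul, smul_eq_mul, mul_comm]
      rfl
    · intro j _ hj
      have h0 := hf.deriv_eq_zero A hA (x s) hmem j hj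
      unfold partialDeriv at h0
      rw [map_smul, smul_eq_mul, h0, mul_zero]
  obtain ⟨c, hc, hceq⟩ := exists_hasDerivAt_eq_slope (fun s => f A (x s)) _ zero_lt_one
    (fun s hs => (hFd s hs).continuousAt.continuousWithinAt)
    (fun s hs => hFd s (Set.Ioo_subset_Icc_self hs))
  refine ⟨θ c, hθmem c (Set.Ioo_subset_Icc_self hc), ?_⟩
  rw [hceq]
  simp [hx, hθ]

/-- Cauchy–Schwarz: the weights x_j(1 - x_j) in the Gini norm are exactly the factors (sin θ_j cos
θ_j)² produced by the chain rule. -/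
lemma interior_sub_le (hf : IsMonotonicGiniSmooth 𝒜 f γinf γg) {A : Finset (Fin L)} (hA : A ∈ 𝒜)
    {φ ψ : Fin L → ℝ} (hφ : ∀ j, 0 < φ j ∧ φ j < Real.pi / 2)
    (hψ : ∀ j, 0 < ψ j ∧ ψ j < Real.pi / 2) :
    f A (fun j => Real.sin (ψ j) ^ 2) - f A (fun j => Real.sin (φ j) ^ 2)
      ≤ 2 * γg * √(∑ j ∈ A, (ψ j - φ j) ^ 2) := by
  obtain ⟨θ, hθ, heq⟩ := hf.exists_sub_eq hA hφ hψ
  rw [heq]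
  have hg := hf.gini_le A hA _ (sin_sq_mem_openCube hθ)
  set d : Fin L → ℝ := fun j => partialDeriv (f A) j (fun j => Real.sin (θ j) ^ 2) with hd
  have hcs := Real.sum_mul_le_sqrt_mul_sqrt A (fun j => d j * (Real.sin (θ j) * Real.cos (θ j)))
    (fun j => ψ j - φ j)
  have h1 : √(∑ j ∈ A, (d j * (Real.sin (θ j) * Real.cos (θ j))) ^ 2) ≤ γg := by
    refine le_trans (Real.sqrt_le_sqrt ?_) hg
    calc ∑ j ∈ A, (d j * (Real.sin (θ j) * Real.cos (θ j))) ^ 2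
        ≤ ∑ j, (d j * (Real.sin (θ j) * Real.cos (θ j))) ^ 2 :=
          Finset.sum_le_univ_sum_of_nonneg fun j => sq_nonneg _
      _ = _ := by
          refine Finset.sum_congr rfl fun j _ => ?_
          rw [← Real.cos_sq']
          ring
  calc ∑ j ∈ A, d j * (2 * Real.sin (θ j) * Real.cos (θ j) * (ψ j - φ j))
      = 2 * ∑ j ∈ A, d j * (Real.sin (θ j) * Real.cos (θ j)) * (ψ j - φ j) := by
        rw [Finset.mul_sum]
        exact Finset.sum_congr rfl fun j _ => by ring
    _ ≤ 2 * (γg * √(∑ j ∈ A, (ψ j - φ j) ^ 2)) := by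
        gcongr
        exact hcs.trans (mul_le_mul_of_nonneg_right h1 (Real.sqrt_nonneg _))
    _ = _ := by ring

lemma interior_mono (hf : IsMonotonicGiniSmooth 𝒜 f γinf γg) {A : Finset (Fin L)} (hA : A ∈ 𝒜)
    {φ ψ : Fin L → ℝ} (hφ : ∀ j, 0 < φ j ∧ φ j < Real.pi / 2)
    (hψ : ∀ j, 0 < ψ j ∧ ψ j < Real.pi / 2) (hle : ∀ j, φ j ≤ ψ j) :
    f A (fun j => Real.sin (φ j) ^ 2) ≤ f A (fun j => Real.sin (ψ j) ^ 2) := by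
  obtain ⟨θ, hθ, heq⟩ := hf.exists_sub_eq hA hφ hψ
  rw [← sub_nonneg, heq]
  refine Finset.sum_nonneg fun j hj => mul_nonneg
    (hf.deriv_mem A hA _ (sin_sq_mem_openCube hθ) j hj).1 ?_
  have h1 : 0 ≤ Real.sin (θ j) :=
    Real.sin_nonneg_of_nonneg_of_le_pi (hθ j).1.le (by linarith [(hθ j).2, Real.pi_pos])
  have h2 : 0 ≤ Real.cos (θ j) :=
    Real.cos_nonneg_of_neg_pi_div_two_le_of_le (by linarith [(hθ j).1, Real.pi_pos]) (hθ j).2.le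
  have h3 := sub_nonneg.2 (hle j)
  positivity

open Filter Topology in
/-- The value at an angle is a limit of values at angles moved towards `π / 4`. -/
lemma tendsto_shrink (hf : IsMonotonicGiniSmooth 𝒜 f γinf γg) {A : Finset (Fin L)} (hA : A ∈ 𝒜)
    (φ : Fin L → ℝ) :
    Tendsto (fun e : ℝ => f A (fun j => Real.sin ((1 - e) * φ j + e * (Real.pi / 4)) ^ 2))
      (𝓝[>] 0) (𝓝 (f A (fun j => Real.sin (φ j) ^ 2))) := by
  have hc := hf.continuousOn A hA (fun j => Real.sin (φ j) ^ 2) (fun j => sin_sq_mem_Icc _)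
  refine hc.tendsto.comp (tendsto_nhdsWithin_iff.2 ⟨?_, .of_forall fun e j => sin_sq_mem_Icc _⟩)
  refine tendsto_nhdsWithin_of_tendsto_nhds ?_
  have : Continuous fun (e : ℝ) (j : Fin L) => Real.sin ((1 - e) * φ j + e * (Real.pi / 4)) ^ 2 := by
    fun_prop
  convert this.tendsto 0 using 2
  simp

lemma shrink_mem {φ e : ℝ} (hφ : 0 ≤ φ ∧ φ ≤ Real.pi / 2) (he : 0 < e ∧ e < 1) :
    0 < (1 - e) * φ + e * (Real.pi / 4) ∧ (1 - e) * φ + e * (Real.pi / 4) < Real.pi / 2 := by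
  have hpi := Real.pi_pos
  have h1 : 0 ≤ (1 - e) * φ := mul_nonneg (by linarith [he.2]) hφ.1
  have h2 : (1 - e) * φ ≤ (1 - e) * (Real.pi / 2) :=
    mul_le_mul_of_nonneg_left hφ.2 (by linarith [he.2])
  have h3 : 0 < e * (Real.pi / 4) := mul_pos he.1 (by positivity)
  constructor <;> linarith

open Filter Topology in
-- Differentiability holds only in the open cube. Contracting both angle vectors towards π/4 keeps
-- them interior, and continuity on the closed cube passes to the limit.
lemma sub_le (hf : IsMonotonicGiniSmooth 𝒜 f γinf γg) {A : Finset (Fin L)} (hA : A ∈ 𝒜)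
    {φ ψ : Fin L → ℝ} (hφ : ∀ j, 0 ≤ φ j ∧ φ j ≤ Real.pi / 2)
    (hψ : ∀ j, 0 ≤ ψ j ∧ ψ j ≤ Real.pi / 2) :
    f A (fun j => Real.sin (ψ j) ^ 2) - f A (fun j => Real.sin (φ j) ^ 2)
      ≤ 2 * γg * √(∑ j ∈ A, (ψ j - φ j) ^ 2) := by
  have hr : Tendsto (fun e : ℝ => 2 * γg * √(∑ j ∈ A, ((1 - e) * (ψ j - φ j)) ^ 2)) (𝓝[>] 0)
      (𝓝 (2 * γg * √(∑ j ∈ A, (ψ j - φ j) ^ 2))) := by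
    refine tendsto_nhdsWithin_of_tendsto_nhds ?_
    have : Continuous fun e : ℝ => 2 * γg * √(∑ j ∈ A, ((1 - e) * (ψ j - φ j)) ^ 2) := by fun_prop
    convert this.tendsto 0 using 2
    simp
  refine le_of_tendsto_of_tendsto ((hf.tendsto_shrink hA ψ).sub (hf.tendsto_shrink hA φ)) hr ?_
  filter_upwards [Ioo_mem_nhdsGT (zero_lt_one' ℝ)] with e he
  refine (hf.interior_sub_le hA (fun j => shrink_mem (hφ j) he)
    fun j => shrink_mem (hψ j) he).trans (le_of_eq ?_)
  congr 3
  funext j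
  ring

open Filter Topology in
lemma mono_angle (hf : IsMonotonicGiniSmooth 𝒜 f γinf γg) {A : Finset (Fin L)} (hA : A ∈ 𝒜)
    {φ ψ : Fin L → ℝ} (hφ : ∀ j, 0 ≤ φ j ∧ φ j ≤ Real.pi / 2)
    (hψ : ∀ j, 0 ≤ ψ j ∧ ψ j ≤ Real.pi / 2) (hle : ∀ j, φ j ≤ ψ j) :
    f A (fun j => Real.sin (φ j) ^ 2) ≤ f A (fun j => Real.sin (ψ j) ^ 2) := by
  refine le_of_tendsto_of_tendsto (hf.tendsto_shrink hA φ) (hf.tendsto_shrink hA ψ) ?_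
  filter_upwards [Ioo_mem_nhdsGT (zero_lt_one' ℝ)] with e he
  refine hf.interior_mono hA (fun j => shrink_mem (hφ j) he) (fun j => shrink_mem (hψ j) he)
    fun j => ?_
  have := mul_le_mul_of_nonneg_left (hle j) (sub_nonneg.2 he.2.le)
  linarith

/-- The increase of a Gini-smooth function under a Bernstein-type deviation of its parameters. -/
lemma mono_and_sub_le (hf : IsMonotonicGiniSmooth 𝒜 f γinf γg) {A : Finset (Fin L)} (hA : A ∈ 𝒜)
    {p q u : Fin L → ℝ} (hp : p ∈ closedCube L) (hq : q ∈ closedCube L) (hu : ∀ j, 0 ≤ u j)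
    (hpq : ∀ j, p j ≤ q j)
    (h : ∀ j, q j - p j ≤ 5 * √(p j * (1 - p j)) * u j + 18 * u j ^ 2) (hγ : 0 ≤ γg) :
    f A p ≤ f A q ∧ f A q - f A p ≤ 24 * γg * √(∑ j ∈ A, u j ^ 2) := by
  set a : ℝ → ℝ := fun x => Real.arcsin (√x) with ha
  have hmem : ∀ x, 0 ≤ a x ∧ a x ≤ Real.pi / 2 := fun x =>
    ⟨Real.arcsin_nonneg.2 (Real.sqrt_nonneg _), Real.arcsin_le_pi_div_two _⟩
  have hsin : ∀ x, 0 ≤ x → x ≤ 1 → Real.sin (a x) ^ 2 = x := by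
    intro x h0 h1
    rw [ha]
    dsimp only
    rw [Real.sin_arcsin (by linarith [Real.sqrt_nonneg x]) (Real.sqrt_le_one.2 h1), Real.sq_sqrt h0]
  have hpe : (fun j => Real.sin (a (p j)) ^ 2) = p := funext fun j => hsin _ (hp j).1 (hp j).2
  have hqe : (fun j => Real.sin (a (q j)) ^ 2) = q := funext fun j => hsin _ (hq j).1 (hq j).2
  have hmono : ∀ j, a (p j) ≤ a (q j) := fun j =>
    Real.monotone_arcsin (Real.sqrt_le_sqrt (hpq j))
  have h1 := hf.mono_angle hA (fun j => hmem (p j)) (fun j => hmem (q j)) hmono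
  have h2 := hf.sub_le hA (fun j => hmem (p j)) (fun j => hmem (q j))
  rw [hpe, hqe] at h1 h2
  refine ⟨h1, h2.trans ?_⟩
  have h3 : √(∑ j ∈ A, (a (q j) - a (p j)) ^ 2) ≤ 12 * √(∑ j ∈ A, u j ^ 2) := by
    rw [show (12 : ℝ) * √(∑ j ∈ A, u j ^ 2) = √(∑ j ∈ A, (12 * u j) ^ 2) by
      simp_rw [mul_pow]
      rw [← Finset.mul_sum, Real.sqrt_mul (by positivity), Real.sqrt_sq (by norm_num)]]
    refine Real.sqrt_le_sqrt (Finset.sum_le_sum fun j _ => ?_)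
    refine pow_le_pow_left₀ (sub_nonneg.2 (hmono j)) ?_ 2
    refine angle_sub_le (hmem _).1 (hmono j) (hmem _).2 (hu j) ?_
    rw [hsin _ (hp j).1 (hp j).2, hsin _ (hq j).1 (hq j).2]
    exact h j
  nlinarith

end IsMonotonicGiniSmooth

/-! ### Sums over the plays of a sequence of batches -/

section Counting

variable {L : ℕ} {Ω : Type*} (A : ℕ → Ω → Finset (Fin L)) (ω : Ω)

lemma count_zero (j : Fin L) : count A 0 j ω = 0 := by
  simp [count]

lemma count_succ (t : ℕ) (j : Fin L) :
    count A (t + 1) j ω = count A t j ω + if j ∈ A (t + 1) ω then 1 else 0 := by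
  unfold count
  rw [← Finset.insert_Icc_right_eq_Icc_add_one (by omega), Finset.filter_insert]
  split_ifs
  · rw [Finset.card_insert_of_notMem (by simp)]
  · rfl

lemma count_le (t : ℕ) (j : Fin L) : count A t j ω ≤ t := by
  refine (Finset.card_filter_le _ _).trans ?_
  simp

/-- A sum over the plays of an arm is a sum over the values of its counter. -/
lemma sum_ite_mem_count (f : ℕ → ℝ) (T : ℕ) (j : Fin L) :
    ∑ t ∈ Finset.range T, (if j ∈ A (t + 1) ω then f (count A t j ω) else 0)
      = ∑ s ∈ Finset.range (count A T j ω), f s := by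
  induction T with
  | zero => simp [count_zero]
  | succ T ih =>
    rw [Finset.sum_range_succ, ih, count_succ]
    split_ifs
    · rw [Finset.sum_range_succ]
    · simp

/-- The successive plays of one arm see the counter values 0, 1, 2, … once each, so each arm
contributes at most F. -/
lemma sum_sum_mem_le {f : ℕ → ℝ} {F : ℝ} (hF : ∀ n, ∑ s ∈ Finset.range n, f s ≤ F) (T : ℕ) :
    ∑ t ∈ Finset.range T, ∑ j ∈ A (t + 1) ω, f (count A t j ω) ≤ L * F := by
  calc ∑ t ∈ Finset.range T, ∑ j ∈ A (t + 1) ω, f (count A t j ω)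
      = ∑ t ∈ Finset.range T, ∑ j, (if j ∈ A (t + 1) ω then f (count A t j ω) else 0) := by
        refine Finset.sum_congr rfl fun t _ => ?_
        rw [← Finset.sum_filter]
        simp
    _ = ∑ j, ∑ s ∈ Finset.range (count A T j ω), f s := by
        rw [Finset.sum_comm]
        exact Finset.sum_congr rfl fun j _ => sum_ite_mem_count A ω f T j
    _ ≤ ∑ _j : Fin L, F := Finset.sum_le_sum fun j _ => hF _
    _ = L * F := by simp

end Counting

/-- Telescoping of 1/√(n+1) ≤ 2√(n+1) - 2√n. The term s = 0 vanishes because division by zero gives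
0. -/
lemma sum_range_ite_inv_sqrt_le {a : ℝ} (n : ℕ) :
    ∑ s ∈ Finset.range n, (if (s : ℝ) ≤ a then 1 / √(s : ℝ) else 0) ≤ 2 * √a := by
  have key : ∀ n : ℕ, ∑ s ∈ Finset.range (n + 1), (if (s : ℝ) ≤ a then 1 / √(s : ℝ) else 0)
      ≤ 2 * √(min a n) := by
    intro n
    induction n with
    | zero => simp
    | succ n ih =>
      rw [Finset.sum_range_succ]
      split_ifs with h
      · push_cast at h
        rw [min_eq_right (by linarith)] at ih
        rw [min_eq_right (by exact_mod_cast h)]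
        have h0 : (0 : ℝ) < ((n + 1 : ℕ) : ℝ) := by positivity
        have h1 := Real.sqrt_pos.2 h0
        have h2 : √(n : ℝ) ≤ √((n + 1 : ℕ) : ℝ) := Real.sqrt_le_sqrt (by push_cast; linarith)
        have h3 := Real.sq_sqrt h0.le
        have h4 := Real.sq_sqrt (Nat.cast_nonneg (α := ℝ) n)
        push_cast at h1 h2 h3 ⊢
        have h5 : 1 / √((n : ℝ) + 1) ≤ 2 * √((n : ℝ) + 1) - 2 * √(n : ℝ) := by
          rw [div_le_iff₀ h1]
          nlinarith [sq_nonneg (√((n : ℝ) + 1) - √(n : ℝ))]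
        linarith
      · rw [add_zero]
        refine ih.trans ?_
        gcongr
        linarith
  rcases n with _ | n
  · simp
  refine (key n).trans ?_
  gcongr
  exact min_le_left _ _

/-- The first integer above a contributes at most 1; the later terms telescope through 1/(n+1) ≤
log(n+1) - log n. -/
lemma sum_range_ite_inv_le {a b : ℝ} (ha : 0 < a) (hab : a ≤ b) (n : ℕ) :
    ∑ s ∈ Finset.range n, (if a < s ∧ (s : ℝ) ≤ b then 1 / (s : ℝ) else 0)
      ≤ 1 + Real.log (b / a) := by
  have hlog : ∀ x, a ≤ x → 0 ≤ Real.log (x / a) := fun x hx =>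
    Real.log_nonneg ((one_le_div ha).2 hx)
  have key : ∀ n : ℕ, ∑ s ∈ Finset.range (n + 1), (if a < s ∧ (s : ℝ) ≤ b then 1 / (s : ℝ) else 0)
      ≤ if (n : ℝ) ≤ a then 0 else 1 + Real.log (min b n / a) := by
    intro n
    induction n with
    | zero => simp [ha.le]
    | succ n ih =>
      rw [Finset.sum_range_succ]
      by_cases h1 : ((n + 1 : ℕ) : ℝ) ≤ a
      · rw [if_pos h1, if_neg (fun h => absurd h.1 (not_lt.2 h1)), add_zero]
        rwa [if_pos (by push_cast at h1; linarith)] at ih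
      · rw [if_neg h1]
        push Not at h1
        by_cases h2 : (n : ℝ) ≤ a
        · rw [if_pos h2] at ih
          have h3 := hlog (min b ((n + 1 : ℕ) : ℝ)) (le_min hab h1.le)
          have h4 : (if a < ((n + 1 : ℕ) : ℝ) ∧ ((n + 1 : ℕ) : ℝ) ≤ b then
              1 / ((n + 1 : ℕ) : ℝ) else 0) ≤ 1 := by
            split_ifs
            · rw [div_le_one (by positivity)]
              push_cast
              linarith [Nat.cast_nonneg (α := ℝ) n]
            · norm_num
          linarith
        · rw [if_neg h2] at ih
          push Not at h2
          have hn : (0 : ℝ) < n := ha.trans h2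
          split_ifs with h3
          · have h4 := h3.2
            rw [min_eq_right h4]
            push_cast at h4 ⊢
            rw [min_eq_right (by linarith)] at ih
            have h5 := Real.one_sub_inv_le_log_of_pos (x := ((n : ℝ) + 1) / n) (by positivity)
            have h6 : 1 - (((n : ℝ) + 1) / n)⁻¹ = 1 / ((n : ℝ) + 1) := by
              field_simp
              ring
            rw [h6, Real.log_div (by positivity) hn.ne'] at h5
            rw [Real.log_div hn.ne' ha.ne'] at ih
            rw [Real.log_div (by positivity) ha.ne']
            linarith
          · rw [add_zero]
            refine ih.trans ?_
            gcongr 1 + Real.log (?_ / a)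
            · exact div_pos (lt_min (ha.trans_le hab) hn) ha
            · exact min_le_min le_rfl (by push_cast; linarith)
  rcases n with _ | n
  · simpa using (by linarith [hlog b hab] : 0 ≤ 1 + Real.log (b / a))
  refine (key n).trans ?_
  split_ifs with h
  · linarith [hlog b hab]
  · push Not at h
    gcongr 1 + Real.log (?_ / a)
    · exact div_pos (lt_min (ha.trans_le hab) (ha.trans h)) ha
    · exact min_le_left _ _

lemma sqrt_add_le_add_sqrt {x y : ℝ} (hx : 0 ≤ x) (hy : 0 ≤ y) : √(x + y) ≤ √x + √y := by
  rw [Real.sqrt_le_left (by positivity), add_sq, Real.sq_sqrt hx, Real.sq_sqrt hy]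
  have := mul_nonneg (Real.sqrt_nonneg x) (Real.sqrt_nonneg y)
  linarith

lemma sqrt_sum_le_sum_sqrt {ι : Type*} (s : Finset ι) {f : ι → ℝ} (hf : ∀ i, 0 ≤ f i) :
    √(∑ i ∈ s, f i) ≤ ∑ i ∈ s, √(f i) := by
  classical
  induction s using Finset.induction_on with
  | empty => simp
  | insert i s hi ih =>
    rw [Finset.sum_insert hi, Finset.sum_insert hi]
    refine (sqrt_add_le_add_sqrt (hf i) (Finset.sum_nonneg fun i _ => hf i)).trans ?_
    gcongr

/-- The sum of the radii of the confidence balls of the batches of a sequence. -/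
lemma sum_sqrt_sum_inv_count_le {L K T : ℕ} {Ω : Type*} (A : ℕ → Ω → Finset (Fin L)) (ω : Ω)
    (hK : 1 ≤ K) (hT : 1 ≤ T) (hcard : ∀ t < T, (A (t + 1) ω).card ≤ K) :
    ∑ t ∈ Finset.range T, √(∑ j ∈ A (t + 1) ω, 1 / (count A t j ω : ℝ))
      ≤ (3 + √(1 + Real.log K)) * √(L * T) := by
  rcases Nat.eq_zero_or_pos L with rfl | hL
  · simp [Finset.eq_empty_of_isEmpty]
  have hL' : (0 : ℝ) < L := by exact_mod_cast hL
  have hT' : (0 : ℝ) < T := by exact_mod_cast hT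
  have hK' : (1 : ℝ) ≤ K := by exact_mod_cast hK
  -- T/L is the average number of plays per arm when a single arm is played in every round. Above b
  -- = Ka, a whole batch adds at most K/b = L/T, so those rounds sum to √(LT). Counters equal to 0
  -- contribute 1/0 = 0.
  set a : ℝ := T / L with ha
  have ha0 : 0 < a := by positivity
  set b : ℝ := K * a with hb
  have hab : a ≤ b := le_mul_of_one_le_left ha0.le hK'
  have hb0 : 0 < b := ha0.trans_le hab
  set g₁ : ℕ → ℝ := fun s => if (s : ℝ) ≤ a then 1 / (s : ℝ) else 0 with hg₁
  set g₂ : ℕ → ℝ := fun s => if a < s ∧ (s : ℝ) ≤ b then 1 / (s : ℝ) else 0 with hg₂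
  have h1nn : ∀ s, 0 ≤ g₁ s := fun s => by
    simp only [hg₁]
    split_ifs <;> positivity
  have h2nn : ∀ s, 0 ≤ g₂ s := fun s => by
    simp only [hg₂]
    split_ifs <;> positivity
  have hsplit : ∀ s : ℕ, 1 / (s : ℝ) ≤ g₁ s + g₂ s + 1 / b := by
    intro s
    have hbp : 0 < 1 / b := by positivity
    simp only [hg₁, hg₂]
    by_cases h1 : (s : ℝ) ≤ a
    · rw [if_pos h1, if_neg (fun h => absurd h.1 (not_lt.2 h1))]
      linarith
    · rw [if_neg h1]
      push Not at h1
      by_cases h2 : (s : ℝ) ≤ b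
      · rw [if_pos ⟨h1, h2⟩]
        linarith
      · rw [if_neg (fun h => h2 h.2)]
        push Not at h2
        have := one_div_le_one_div_of_le hb0 h2.le
        linarith
  have hterm : ∀ t ∈ Finset.range T, √(∑ j ∈ A (t + 1) ω, 1 / (count A t j ω : ℝ))
      ≤ ∑ j ∈ A (t + 1) ω, √(g₁ (count A t j ω)) + √(∑ j ∈ A (t + 1) ω, g₂ (count A t j ω))
        + √(L / T) := by
    intro t ht
    have h1 : ∑ j ∈ A (t + 1) ω, 1 / (count A t j ω : ℝ) ≤
        ∑ j ∈ A (t + 1) ω, g₁ (count A t j ω) + ∑ j ∈ A (t + 1) ω, g₂ (count A t j ω) + L / T := by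
      refine (Finset.sum_le_sum fun j _ => hsplit (count A t j ω)).trans ?_
      rw [Finset.sum_add_distrib, Finset.sum_add_distrib, Finset.sum_const, nsmul_eq_mul]
      gcongr
      have h3 : ((A (t + 1) ω).card : ℝ) ≤ K := by
        exact_mod_cast hcard t (Finset.mem_range.1 ht)
      calc ((A (t + 1) ω).card : ℝ) * (1 / b) ≤ K * (1 / b) := by gcongr
        _ = L / T := by
          rw [hb, ha]
          field_simp
    have hs1 : 0 ≤ ∑ j ∈ A (t + 1) ω, g₁ (count A t j ω) := Finset.sum_nonneg fun _ _ => h1nn _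
    have hs2 : 0 ≤ ∑ j ∈ A (t + 1) ω, g₂ (count A t j ω) := Finset.sum_nonneg fun _ _ => h2nn _
    refine (Real.sqrt_le_sqrt h1).trans ?_
    refine (sqrt_add_le_add_sqrt (by positivity) (by positivity)).trans ?_
    gcongr
    refine (sqrt_add_le_add_sqrt hs1 hs2).trans ?_
    gcongr
    exact sqrt_sum_le_sum_sqrt _ fun j => h1nn _
  have hrootLT : √((L : ℝ) * T) = √L * √T := Real.sqrt_mul hL'.le _
  have hsqL : √(L : ℝ) * √(L : ℝ) = L := Real.mul_self_sqrt hL'.le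
  have hsqT : √(T : ℝ) * √(T : ℝ) = T := Real.mul_self_sqrt hT'.le
  have hsL := Real.sqrt_pos.2 hL'
  have hsT := Real.sqrt_pos.2 hT'
  have hpart1 : ∑ t ∈ Finset.range T, ∑ j ∈ A (t + 1) ω, √(g₁ (count A t j ω))
      ≤ 2 * √(L * T) := by
    refine (sum_sum_mem_le A ω (f := fun s => √(g₁ s)) (F := 2 * √a) (fun n => ?_) T).trans
      (le_of_eq ?_)
    · refine (Finset.sum_le_sum fun s _ => le_of_eq ?_).trans (sum_range_ite_inv_sqrt_le n)
      simp only [hg₁]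
      split_ifs
      · rw [Real.sqrt_div zero_le_one, Real.sqrt_one]
      · exact Real.sqrt_zero
    · rw [ha, Real.sqrt_div hT'.le, hrootLT]
      field_simp
      rw [sq, hsqL]
  have hpart2 : ∑ t ∈ Finset.range T, √(∑ j ∈ A (t + 1) ω, g₂ (count A t j ω))
      ≤ √(1 + Real.log K) * √(L * T) := by
    -- Cauchy–Schwarz over the rounds, unlike the arm-wise subadditivity of the root used for small
    -- counters, leaves only a harmonic sum between a and Ka.
    have h1 := Real.sum_sqrt_mul_sqrt_le (Finset.range T)
      (f := fun t => ∑ j ∈ A (t + 1) ω, g₂ (count A t j ω)) (g := fun _ => 1)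
      (fun t => Finset.sum_nonneg fun _ _ => h2nn _) (fun _ => zero_le_one)
    simp only [Real.sqrt_one, mul_one, Finset.sum_const, Finset.card_range, nsmul_eq_mul] at h1
    refine h1.trans ?_
    have h2 := sum_sum_mem_le A ω (f := g₂) (sum_range_ite_inv_le ha0 hab) T
    have h3 : b / a = K := by
      rw [hb]
      field_simp
    rw [h3] at h2
    refine (mul_le_mul_of_nonneg_right (Real.sqrt_le_sqrt h2) hsT.le).trans (le_of_eq ?_)
    rw [hrootLT, Real.sqrt_mul hL'.le]
    ring
  have hpart3 : ∑ _t ∈ Finset.range T, √((L : ℝ) / T) = √(L * T) := by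
    rw [Finset.sum_const, Finset.card_range, nsmul_eq_mul, Real.sqrt_div hL'.le, hrootLT]
    field_simp
    rw [sq, hsqT]
  refine (Finset.sum_le_sum hterm).trans ?_
  rw [Finset.sum_add_distrib, Finset.sum_add_distrib, hpart3]
  linarith

/-! ### Measurability with respect to the history -/

section History

variable {L M : ℕ} {Ω : Type*} (X : ℕ → Ω → Fin M → Fin L → ℝ) (A : ℕ → Ω → Finset (Fin L))

lemma measurable_feedback_history {τ t : ℕ} (h : τ ∈ Finset.Icc 1 t) :
    Measurable[history X A t] (X τ) := by
  refine Measurable.mono (comap_measurable (X τ)) ?_ le_rfl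
  exact le_sup_left.trans
    (le_biSup (fun τ => MeasurableSpace.comap (X τ) inferInstance ⊔ MeasurableSpace.comap (A τ) ⊤) h)

lemma comap_batch_le_history {τ t : ℕ} (h : τ ∈ Finset.Icc 1 t) :
    MeasurableSpace.comap (A τ) ⊤ ≤ history X A t :=
  le_sup_right.trans
    (le_biSup (fun τ => MeasurableSpace.comap (X τ) inferInstance ⊔ MeasurableSpace.comap (A τ) ⊤) h)

lemma measurableSet_mem_batch_history {τ t : ℕ} (h : τ ∈ Finset.Icc 1 t) (j : Fin L) :
    MeasurableSet[history X A t] {ω | j ∈ A τ ω} :=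
  comap_batch_le_history X A h _ ⟨{B | j ∈ B}, MeasurableSpace.measurableSet_top, rfl⟩

/-- The sum of a function of the feedback over the plays of an arm, as an indicator sum. -/
lemma measurable_sum_filter_history {f : (Fin M → Fin L → ℝ) → ℝ} (hf : Measurable f) (t : ℕ)
    (j : Fin L) :
    Measurable[history X A t]
      fun ω => ∑ τ ∈ (Finset.Icc 1 t).filter (fun τ => j ∈ A τ ω), f (X τ ω) := by
  simp_rw [Finset.sum_filter]
  refine Finset.measurable_sum _ fun τ hτ => ?_
  refine Measurable.ite (measurableSet_mem_batch_history X A hτ j) ?_ measurable_const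
  exact hf.comp (measurable_feedback_history X A hτ)

lemma measurable_count_history (t : ℕ) (j : Fin L) :
    Measurable[history X A t] fun ω => (count A t j ω : ℝ) := by
  have h := measurable_sum_filter_history X A (f := fun _ => 1) measurable_const t j
  simpa [count] using h

lemma measurable_ucbIndex_history (t : ℕ) : Measurable[history X A t] (ucbIndex X A t) := by
  refine @measurable_pi_lambda _ _ _ (history X A t) _ _ fun i => ?_
  refine @measurable_pi_lambda _ _ _ (history X A t) _ _ fun j => ?_
  have hc := measurable_count_history X A t j
  have h1 := measurable_sum_filter_history X A (f := fun x => x i j) (by fun_prop) t j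
  have h2 := measurable_sum_filter_history X A (f := fun x => x i j ^ 2) (by fun_prop) t j
  have hm : Measurable[history X A t] (empMean X A t i j) := h1.div hc
  have hv : Measurable[history X A t] (empVar X A t i j) := (h2.div hc).sub (hm.pow_const 2)
  exact measurable_const.min ((hm.add (((hv.const_mul 6).mul_const _).div hc).sqrt).add
    (measurable_const.div hc))

end History

/-! ### Exponential supermartingale and Chernoff bound for adaptively played arms -/

namespace IsBCUCBRun

variable {L M : ℕ} {Ω : Type*} [mΩ : MeasurableSpace Ω] {μ : Measure Ω} {P : Problem L M}
  {oracle : (Fin M → Fin L → ℝ) → PMF (Finset (Fin L))} {T : ℕ}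
  {X : ℕ → Ω → Fin M → Fin L → ℝ} {A : ℕ → Ω → Finset (Fin L)}

lemma measurable_feedback_of_mem (h : IsBCUCBRun μ P oracle T X A) {t : ℕ} (ht : t ≤ T) {τ : ℕ}
    (hτ : τ ∈ Finset.Icc 1 t) : Measurable (X τ) := by
  rw [Finset.mem_Icc] at hτ
  have := h.measurable_feedback (τ - 1) (by omega)
  rwa [Nat.sub_add_cancel hτ.1] at this

lemma measurable_batch_of_mem (h : IsBCUCBRun μ P oracle T X A) {t : ℕ} (ht : t ≤ T) {τ : ℕ}
    (hτ : τ ∈ Finset.Icc 1 t) : @Measurable _ _ _ ⊤ (A τ) := by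
  rw [Finset.mem_Icc] at hτ
  have := h.measurable_batch (τ - 1) (by omega)
  rw [Nat.sub_add_cancel hτ.1] at this
  exact @measurable_to_countable' _ _ ⊤ _ _ _ this

lemma history_le (h : IsBCUCBRun μ P oracle T X A) {t : ℕ} (ht : t ≤ T) :
    history X A t ≤ mΩ :=
  iSup₂_le fun _ hτ => sup_le (h.measurable_feedback_of_mem ht hτ).comap_le
    (h.measurable_batch_of_mem ht hτ).comap_le

/-- The exponential supermartingale argument: a product over the plays of an arm of factors of
mean at most `1` has mean at most `1`. -/
lemma lintegral_prod_le_one [IsProbabilityMeasure μ] (h : IsBCUCBRun μ P oracle T X A)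
    {g : (Fin M → Fin L → ℝ) → ENNReal} (hg : Measurable g) (hg1 : ∫⁻ x, g x ∂P.law ≤ 1)
    (j : Fin L) {t : ℕ} (ht : t ≤ T) :
    ∫⁻ ω, ∏ τ ∈ Finset.Icc 1 t, (if j ∈ A τ ω then g (X τ ω) else 1) ∂μ ≤ 1 := by
  have hmeas : ∀ s, Measurable[history X A s]
      fun ω => ∏ τ ∈ Finset.Icc 1 s, (if j ∈ A τ ω then g (X τ ω) else 1) := by
    intro s
    refine Finset.measurable_prod _ fun τ hτ => ?_
    exact Measurable.ite (measurableSet_mem_batch_history X A hτ j)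
      (hg.comp (measurable_feedback_history X A hτ)) measurable_const
  induction t with
  | zero => simp
  | succ t ih =>
    have ht' : t < T := ht
    have ih := ih ht'.le
    set Z : Ω → ENNReal :=
      fun ω => ∏ τ ∈ Finset.Icc 1 t, (if j ∈ A τ ω then g (X τ ω) else 1) with hZ
    set S : Set Ω := {ω | j ∈ A (t + 1) ω} with hS
    have hAm : @Measurable _ _ _ ⊤ (A (t + 1)) :=
      h.measurable_batch_of_mem (t := t + 1) ht (by simp)
    have hXm : Measurable (X (t + 1)) := h.measurable_feedback t ht'
    have hm_le : history X A t ⊔ MeasurableSpace.comap (A (t + 1)) ⊤ ≤ mΩ :=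
      sup_le (h.history_le ht'.le) hAm.comap_le
    have hSm : MeasurableSet[history X A t ⊔ MeasurableSpace.comap (A (t + 1)) ⊤] S :=
      (le_sup_right : _ ≤ history X A t ⊔ MeasurableSpace.comap (A (t + 1)) ⊤) _
        ⟨{B | j ∈ B}, MeasurableSpace.measurableSet_top, rfl⟩
    have hZm : Measurable[history X A t ⊔ MeasurableSpace.comap (A (t + 1)) ⊤] Z :=
      (hmeas t).mono le_sup_left le_rfl
    have hsplit : ∀ ω, ∏ τ ∈ Finset.Icc 1 (t + 1), (if j ∈ A τ ω then g (X τ ω) else 1)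
        = (S.indicator Z ω) * g (X (t + 1) ω) + Sᶜ.indicator Z ω := by
      intro ω
      rw [← Finset.insert_Icc_right_eq_Icc_add_one (by omega), Finset.prod_insert (by simp), mul_comm]
      change Z ω * _ = _
      by_cases hω : j ∈ A (t + 1) ω
      · rw [if_pos hω, Set.indicator_of_mem (show ω ∈ S from hω),
          Set.indicator_of_notMem (fun hc : ω ∈ Sᶜ => hc hω), add_zero]
      · rw [if_neg hω, Set.indicator_of_notMem (show ω ∉ S from hω),
          Set.indicator_of_mem (show ω ∈ Sᶜ from hω), zero_mul, zero_add, mul_one]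
    simp_rw [hsplit]
    have hZm0 : Measurable Z := hZm.mono hm_le le_rfl
    have hS0 : MeasurableSet S := hm_le _ hSm
    rw [lintegral_add_right _ (hZm0.indicator hS0.compl)]
    -- Both the past product and whether the arm is played now are independent of the new feedback,
    -- so the new factor can be integrated separately.
    have hind := lintegral_mul_eq_lintegral_mul_lintegral_of_independent_measurableSpace
      (f := S.indicator Z) (g := fun ω => g (X (t + 1) ω)) hm_le hXm.comap_le
      (h.feedback_indep t ht').symm (hZm.indicator hSm) (hg.comp (comap_measurable _))
    rw [hind]
    have hlaw : ∫⁻ ω, g (X (t + 1) ω) ∂μ = ∫⁻ x, g x ∂P.law := by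
      rw [← h.feedback_law t ht', lintegral_map hg hXm]
    rw [hlaw]
    calc (∫⁻ ω, S.indicator Z ω ∂μ) * ∫⁻ x, g x ∂P.law + ∫⁻ ω, Sᶜ.indicator Z ω ∂μ
        ≤ (∫⁻ ω, S.indicator Z ω ∂μ) * 1 + ∫⁻ ω, Sᶜ.indicator Z ω ∂μ := by gcongr
      _ = ∫⁻ ω, Z ω ∂μ := by
        rw [mul_one, lintegral_indicator hS0, lintegral_indicator hS0.compl,
          lintegral_add_compl _ hS0]
      _ ≤ 1 := ih

/-- Chernoff's bound for the sum of a function of the feedback over the first `s` plays of an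
arm. -/
lemma measure_count_eq_and_le_sum [IsProbabilityMeasure μ] (h : IsBCUCBRun μ P oracle T X A)
    {ξ : (Fin M → Fin L → ℝ) → ℝ} (hξ : Measurable ξ) {lam κ : ℝ} (hlam : 0 ≤ lam)
    (hmgf : ∫⁻ x, ENNReal.ofReal (Real.exp (lam * ξ x)) ∂P.law ≤ ENNReal.ofReal (Real.exp κ))
    (j : Fin L) {t : ℕ} (ht : t ≤ T) (s : ℕ) (b : ℝ) :
    μ {ω | count A t j ω = s ∧
        b ≤ ∑ τ ∈ (Finset.Icc 1 t).filter (fun τ => j ∈ A τ ω), ξ (X τ ω)}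
      ≤ ENNReal.ofReal (Real.exp (s * κ - lam * b)) := by
  set g : (Fin M → Fin L → ℝ) → ENNReal :=
    fun x => ENNReal.ofReal (Real.exp (lam * ξ x - κ)) with hg
  have hgm : Measurable g := by fun_prop
  have hg1 : ∫⁻ x, g x ∂P.law ≤ 1 := by
    have h1 : ∀ x, g x = ENNReal.ofReal (Real.exp (lam * ξ x)) * ENNReal.ofReal (Real.exp (-κ)) := by
      intro x
      rw [← ENNReal.ofReal_mul (Real.exp_pos _).le, ← Real.exp_add, ← sub_eq_add_neg]
    simp_rw [h1]
    rw [lintegral_mul_const _ (by fun_prop)]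
    refine (mul_le_mul_left hmgf _).trans (le_of_eq ?_)
    rw [← ENNReal.ofReal_mul (Real.exp_pos _).le, ← Real.exp_add]
    simp
  have hle := h.lintegral_prod_le_one hgm hg1 j ht
  set Z : Ω → ENNReal :=
    fun ω => ∏ τ ∈ Finset.Icc 1 t, (if j ∈ A τ ω then g (X τ ω) else 1) with hZ
  have hZm : Measurable Z := by
    refine (Finset.measurable_prod _ fun τ hτ => ?_ : Measurable[history X A t] Z).mono
      (h.history_le ht) le_rfl
    exact Measurable.ite (measurableSet_mem_batch_history X A hτ j)
      (hgm.comp (measurable_feedback_history X A hτ)) measurable_const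
  have hZeq : ∀ ω, Z ω = ENNReal.ofReal (Real.exp
      (lam * ∑ τ ∈ (Finset.Icc 1 t).filter (fun τ => j ∈ A τ ω), ξ (X τ ω)
        - count A t j ω * κ)) := by
    intro ω
    rw [hZ]
    dsimp only
    rw [← Finset.prod_filter, hg]
    rw [← ENNReal.ofReal_prod_of_nonneg fun _ _ => (Real.exp_pos _).le, ← Real.exp_sum,
      Finset.sum_sub_distrib, Finset.sum_const, nsmul_eq_mul, Finset.mul_sum]
    rfl
  have hmarkov := mul_meas_ge_le_lintegral (μ := μ) hZm (ENNReal.ofReal (Real.exp (lam * b - s * κ)))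
  have hsub : {ω | count A t j ω = s ∧
        b ≤ ∑ τ ∈ (Finset.Icc 1 t).filter (fun τ => j ∈ A τ ω), ξ (X τ ω)}
      ⊆ {ω | ENNReal.ofReal (Real.exp (lam * b - s * κ)) ≤ Z ω} := by
    rintro ω ⟨h1, h2⟩
    rw [Set.mem_ofPred_eq, hZeq, h1]
    gcongr
  have hneg : Real.exp (s * κ - lam * b) = (Real.exp (lam * b - s * κ))⁻¹ := by
    rw [← Real.exp_neg, neg_sub]
  rw [hneg, ENNReal.ofReal_inv_of_pos (Real.exp_pos _), ENNReal.le_inv_iff_mul_le, mul_comm]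
  exact (mul_le_mul_right (measure_mono hsub) _).trans (hmarkov.trans hle)

end IsBCUCBRun

/-! ### Moment generating functions -/

section Mgf

variable {α : Type*} [MeasurableSpace α] {ν : Measure α} [IsProbabilityMeasure ν] {Y : α → ℝ}

/-- Bernstein's bound for the moment generating function of a centered bounded variable. -/
lemma lintegral_exp_le_of_abs_le_one (hY : Measurable Y) (hb : ∀ᵐ x ∂ν, |Y x| ≤ 1)
    (h0 : ∫ x, Y x ∂ν = 0) {V : ℝ} (hV : ∫ x, Y x ^ 2 ∂ν ≤ V) {lam : ℝ} (hl : 0 ≤ lam)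
    (hl3 : lam < 3) :
    ∫⁻ x, ENNReal.ofReal (Real.exp (lam * Y x)) ∂ν
      ≤ ENNReal.ofReal (Real.exp (lam ^ 2 * V / (2 * (1 - lam / 3)))) := by
  have hpos : 0 < 1 - lam / 3 := by linarith
  have hi1 : Integrable Y ν := Integrable.of_bound hY.aestronglyMeasurable 1 hb
  have hi2 : Integrable (fun x => Y x ^ 2) ν := by
    refine Integrable.of_bound (hY.pow_const 2).aestronglyMeasurable 1 ?_
    filter_upwards [hb] with x hx
    rw [Real.norm_eq_abs, abs_pow]
    exact pow_le_one₀ (abs_nonneg _) hx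
  set c := lam ^ 2 / (2 * (1 - lam / 3)) with hc
  have hc0 : 0 ≤ c := by positivity
  have hle : ∀ᵐ x ∂ν, Real.exp (lam * Y x) ≤ 1 + lam * Y x + c * Y x ^ 2 := by
    filter_upwards [hb] with x hx
    have h1 := exp_le_of_le_of_lt_three hl hl3
      (mul_le_of_le_one_right hl ((le_abs_self _).trans hx))
    rw [mul_pow, mul_div_right_comm] at h1
    exact h1
  have hint : Integrable (fun x => 1 + lam * Y x + c * Y x ^ 2) ν :=
    ((integrable_const 1).add (hi1.const_mul lam)).add (hi2.const_mul c)
  have hval : ∫ x, (1 + lam * Y x + c * Y x ^ 2) ∂ν = 1 + c * ∫ x, Y x ^ 2 ∂ν := by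
    have hi3 : Integrable (fun x => 1 + lam * Y x) ν := (integrable_const 1).add (hi1.const_mul lam)
    rw [integral_add hi3 (hi2.const_mul c), integral_add (integrable_const 1) (hi1.const_mul lam),
      integral_const_mul,
      integral_const_mul, h0]
    simp
  calc ∫⁻ x, ENNReal.ofReal (Real.exp (lam * Y x)) ∂ν
      ≤ ∫⁻ x, ENNReal.ofReal (1 + lam * Y x + c * Y x ^ 2) ∂ν :=
        lintegral_mono_ae (hle.mono fun x hx => ENNReal.ofReal_le_ofReal hx)
    _ = ENNReal.ofReal (1 + c * ∫ x, Y x ^ 2 ∂ν) := by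
        rw [← ofReal_integral_eq_lintegral_ofReal hint
          (hle.mono fun x hx => (Real.exp_pos _).le.trans hx), hval]
    _ ≤ _ := by
        refine ENNReal.ofReal_le_ofReal ?_
        rw [mul_div_right_comm]
        have h2 := mul_le_mul_of_nonneg_left hV hc0
        linarith [Real.add_one_le_exp (c * V)]

/-- The moment generating function of the negative of a variable with values in `[0, 1]`. -/
lemma lintegral_exp_mean_sub_le (hY : Measurable Y) (hb : ∀ᵐ x ∂ν, 0 ≤ Y x ∧ Y x ≤ 1)
    {V : ℝ} (hV : ∫ x, Y x ∂ν ≤ V) {lam : ℝ} (hl : 0 ≤ lam) :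
    ∫⁻ x, ENNReal.ofReal (Real.exp (lam * (∫ y, Y y ∂ν - Y x))) ∂ν
      ≤ ENNReal.ofReal (Real.exp (lam ^ 2 * V / 2)) := by
  set v := ∫ y, Y y ∂ν with hv
  have hi1 : Integrable Y ν := by
    refine Integrable.of_bound hY.aestronglyMeasurable 1 ?_
    filter_upwards [hb] with x hx
    rw [Real.norm_eq_abs, abs_of_nonneg hx.1]
    exact hx.2
  have hle : ∀ᵐ x ∂ν, Real.exp (lam * (v - Y x))
      ≤ Real.exp (lam * v) * (1 - lam * Y x + lam ^ 2 / 2 * Y x) := by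
    filter_upwards [hb] with x hx
    rw [mul_sub, sub_eq_add_neg, Real.exp_add]
    gcongr
    refine (exp_neg_le_quadratic (mul_nonneg hl hx.1)).trans ?_
    have : Y x ^ 2 ≤ Y x := by nlinarith [hx.1, hx.2]
    nlinarith [mul_le_mul_of_nonneg_left this (sq_nonneg lam)]
  have hint : Integrable (fun x => Real.exp (lam * v) * (1 - lam * Y x + lam ^ 2 / 2 * Y x)) ν :=
    (((integrable_const 1).sub (hi1.const_mul lam)).add (hi1.const_mul _)).const_mul _
  have hval : ∫ x, Real.exp (lam * v) * (1 - lam * Y x + lam ^ 2 / 2 * Y x) ∂ν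
      = Real.exp (lam * v) * (1 - lam * v + lam ^ 2 / 2 * v) := by
    have hi3 : Integrable (fun x => 1 - lam * Y x) ν := (integrable_const 1).sub (hi1.const_mul lam)
    rw [integral_const_mul, integral_add hi3 (hi1.const_mul _), integral_sub (integrable_const 1) (hi1.const_mul lam),
      integral_const_mul,
      integral_const_mul]
    simp [hv]
  calc ∫⁻ x, ENNReal.ofReal (Real.exp (lam * (v - Y x))) ∂ν
      ≤ ∫⁻ x, ENNReal.ofReal (Real.exp (lam * v) * (1 - lam * Y x + lam ^ 2 / 2 * Y x)) ∂ν :=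
        lintegral_mono_ae (hle.mono fun x hx => ENNReal.ofReal_le_ofReal hx)
    _ = ENNReal.ofReal (Real.exp (lam * v) * (1 - lam * v + lam ^ 2 / 2 * v)) := by
        rw [← ofReal_integral_eq_lintegral_ofReal hint
          (hle.mono fun x hx => (Real.exp_pos _).le.trans hx), hval]
    _ ≤ _ := by
        refine ENNReal.ofReal_le_ofReal ?_
        have h1 : 1 - lam * v + lam ^ 2 / 2 * v ≤ Real.exp (-(lam * v) + lam ^ 2 * V / 2) := by
          have h2 := Real.add_one_le_exp (-(lam * v) + lam ^ 2 * V / 2)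
          nlinarith [mul_le_mul_of_nonneg_left hV (sq_nonneg lam)]
        refine (mul_le_mul_of_nonneg_left h1 (Real.exp_pos _).le).trans (le_of_eq ?_)
        rw [← Real.exp_add]
        congr 1
        ring

end Mgf

/-! ### The confidence bounds -/

lemma sqrt_six_bounds : 0 < √(6 : ℝ) ∧ √(6 : ℝ) ^ 2 = 6 ∧ √(6 : ℝ) ≤ 5 / 2 := by
  refine ⟨by positivity, Real.sq_sqrt (by norm_num), ?_⟩
  rw [Real.sqrt_le_left (by norm_num)]
  norm_num

/-- The empirical Bernstein index is an upper confidence bound. -/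
lemma le_index_of_deviation {p v u σ m W V : ℝ} (hu : 0 < u) (hp1 : p ≤ 1) (hm : 0 ≤ m)
    (hv : v ≤ 1 / 4) (hσ : 0 < σ) (hσv : σ ^ 2 = max v (u ^ 2))
    (h1 : p - m ≤ √6 * σ * u + u ^ 2) (h2 : v - W ≤ √6 * σ * u) (hW : W = V + (m - p) ^ 2) :
    p ≤ min 1 (m + √(6 * V * u ^ 2) + 9 * u ^ 2) := by
  obtain ⟨hR0, hR2, hR⟩ := sqrt_six_bounds
  set R := √(6 : ℝ) with hRdef
  refine le_min hp1 ?_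
  have hsq := Real.sqrt_nonneg (6 * V * u ^ 2)
  -- When v ≤ u², σ = u and the deviation (√6 + 1)u² is covered by 9u² alone.
  rcases le_or_gt v (u ^ 2) with hc | hc
  · rw [max_eq_right hc] at hσv
    have hσu : σ = u := (pow_left_inj₀ hσ.le hu.le two_ne_zero).1 hσv
    rw [hσu] at h1
    nlinarith
  rw [max_eq_left hc.le] at hσv
  by_contra hcon
  push Not at hcon
  have hroot : √(6 * V * u ^ 2) = √(6 * V) * u := by
    rw [Real.sqrt_mul' _ (sq_nonneg u), Real.sqrt_sq hu.le]
  rw [hroot] at hcon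
  set b := √(6 * V) with hb
  have hb0 : 0 ≤ b := Real.sqrt_nonneg _
  have hb2 : 6 * V ≤ b ^ 2 := by
    rcases le_or_gt 0 (6 * V) with h | h
    · rw [hb, Real.sq_sqrt h]
    · exact h.le.trans (sq_nonneg _)
  set z := R * σ with hz
  have hz2 : z ^ 2 = 6 * v := by rw [hz, mul_pow, hR2, hσv]
  have hz0 : 0 < z := by positivity
  -- With z = √(6v), the assumed failure p - m > bu + 9u² meets p - m ≤ zu + u². Inserting b < z -
  -- 8u into the bound on v - W gives 10z ≤ 64u + 6u(z + u)². But u ≤ z/8, and v ≤ 1/4 gives (z +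
  -- u)² ≤ 2, so the right side is at most 9.5z.
  have hzb : b + 8 * u < z := by nlinarith
  have hd0 : 0 ≤ p - m := by nlinarith
  have hd2 : (m - p) ^ 2 ≤ (z * u + u ^ 2) ^ 2 := by
    rw [← neg_sub, neg_sq]
    exact pow_le_pow_left₀ hd0 h1 2
  have h3 : b ^ 2 ≤ (z - 8 * u) ^ 2 := pow_le_pow_left₀ hb0 (by linarith) 2
  have h4 : 10 * z * u ≤ 64 * u ^ 2 + 6 * (z * u + u ^ 2) ^ 2 := by nlinarith
  have h5 : 10 * z ≤ 64 * u + 6 * u * (z + u) ^ 2 := by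
    refine le_of_mul_le_mul_right ?_ hu
    nlinarith
  have h6 : u ≤ z / 8 := by linarith
  have h7 : (z + u) ^ 2 ≤ (9 / 8 * z) ^ 2 := pow_le_pow_left₀ (by positivity) (by linarith) 2
  have h8 : (z + u) ^ 2 ≤ 2 := by nlinarith
  nlinarith

/-- The empirical Bernstein index is not much larger than the mean. -/
lemma index_sub_le_of_deviation {p v u σ m V : ℝ} (hu : 0 < u) (hp0 : 0 ≤ p) (hp1 : p ≤ 1)
    (hm0 : 0 ≤ m) (hm1 : m ≤ 1) (hvp : v ≤ p * (1 - p)) (hσ : 0 < σ)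
    (hσv : σ ^ 2 = max v (u ^ 2)) (h1 : p - m ≤ √6 * σ * u + u ^ 2)
    (h3 : m - p ≤ √6 * σ * u + u ^ 2) (hV : V ≤ m * (1 - m)) :
    min 1 (m + √(6 * V * u ^ 2) + 9 * u ^ 2) - p ≤ 5 * √(p * (1 - p)) * u + 18 * u ^ 2 := by
  obtain ⟨hR0, hR2, hR⟩ := sqrt_six_bounds
  have hg0 := Real.sqrt_nonneg (p * (1 - p))
  have hg2 := Real.sq_sqrt (mul_nonneg hp0 (sub_nonneg.2 hp1))
  set g := √(p * (1 - p)) with hg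
  have hroot : √(6 * V * u ^ 2) = √6 * √V * u := by
    rw [Real.sqrt_mul' _ (sq_nonneg u), Real.sqrt_sq hu.le, Real.sqrt_mul (by norm_num)]
  rw [hroot]
  set R := √(6 : ℝ) with hRdef
  have hσg : σ ≤ g + u := by
    rw [← pow_le_pow_iff_left₀ hσ.le (by positivity) two_ne_zero, hσv]
    refine max_le ?_ ?_ <;> nlinarith [mul_nonneg hg0 hu.le]
  have hdev : R * σ * u ≤ R * (g + u) * u := by gcongr
  have habs : |m - p| ≤ R * (g + u) * u + u ^ 2 := abs_le.2 ⟨by linarith, by linarith⟩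
  -- The map x ↦ x(1 - x) is 1-Lipschitz on [0,1], so V ≤ g² + |m - p|.
  have hVg : √V ≤ g + 2 * u := by
    rw [Real.sqrt_le_left (by positivity)]
    have h4 : m * (1 - m) - p * (1 - p) ≤ |m - p| := by
      rcases abs_cases (m - p) with ⟨h, _⟩ | ⟨h, _⟩ <;> rw [h] <;> nlinarith
    have h5 : R * (g + u) * u ≤ 5 / 2 * (g + u) * u := by gcongr
    nlinarith [mul_nonneg hg0 hu.le, sq_nonneg u]
  have h6 : R * √V * u ≤ 5 / 2 * (g + 2 * u) * u := by gcongr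
  have h7 : R * (g + u) * u ≤ 5 / 2 * (g + u) * u := by gcongr
  have h8 := min_le_right 1 (m + R * √V * u + 9 * u ^ 2)
  -- The u² coefficients from the mean deviation, the variance root and the bonus total 5/2 + 1 + 5
  -- + 9 = 17.5 ≤ 18.
  nlinarith

/-! ### Moments of a single feedback entry -/

namespace Problem

variable {L M : ℕ} (P : Problem L M) (i : Fin M) (j : Fin L)

/-- The variance of one entry of the feedback. -/
noncomputable def entryVar : ℝ := ∫ x, (x i j - P.mean i j) ^ 2 ∂P.law

lemma ae_entry_mem : ∀ᵐ x ∂P.law, 0 ≤ x i j ∧ x i j ≤ 1 :=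
  P.law_mem.mono fun _ hx => hx i j

lemma integrable_entry : Integrable (fun x => x i j) P.law := by
  have := P.law_isProbabilityMeasure
  have hm : Measurable fun x : Fin M → Fin L → ℝ => x i j := by fun_prop
  refine Integrable.of_bound hm.aestronglyMeasurable 1 ?_
  filter_upwards [P.ae_entry_mem i j] with x hx
  rw [Real.norm_eq_abs, abs_of_nonneg hx.1]
  exact hx.2

lemma mean_mem : 0 ≤ P.mean i j ∧ P.mean i j ≤ 1 := by
  have := P.law_isProbabilityMeasure
  constructor
  · exact integral_nonneg_of_ae ((P.ae_entry_mem i j).mono fun x hx => hx.1)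
  · have h := integral_mono_ae (P.integrable_entry i j) (integrable_const (1 : ℝ))
      ((P.ae_entry_mem i j).mono fun x hx => hx.2)
    simpa [mean] using h

lemma mean_mem_closedCube : P.mean i ∈ closedCube L := fun j => P.mean_mem i j

lemma entryVar_le : P.entryVar i j ≤ P.mean i j * (1 - P.mean i j) := by
  have := P.law_isProbabilityMeasure
  set p := P.mean i j with hp
  have hi := P.integrable_entry i j
  have h1 : Integrable (fun x => (1 - 2 * p) * x i j + p ^ 2) P.law :=
    (hi.const_mul _).add (integrable_const _)
  have h2 : ∫ x, ((1 - 2 * p) * x i j + p ^ 2) ∂P.law = p * (1 - p) := by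
    rw [integral_add (hi.const_mul _) (integrable_const _), integral_const_mul]
    change (1 - 2 * p) * p + _ = _
    simp
    ring
  rw [← h2]
  refine integral_mono_of_nonneg (.of_forall fun _ => sq_nonneg _) h1 ?_
  filter_upwards [P.ae_entry_mem i j] with x hx
  nlinarith [hx.1, hx.2]

lemma entryVar_le_quarter : P.entryVar i j ≤ 1 / 4 := by
  refine (P.entryVar_le i j).trans ?_
  nlinarith [sq_nonneg (P.mean i j - 1 / 2)]

lemma integral_sub_mean : ∫ x, (x i j - P.mean i j) ∂P.law = 0 := by
  have := P.law_isProbabilityMeasure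
  rw [integral_sub (P.integrable_entry i j) (integrable_const _)]
  simp [mean]

lemma ae_abs_sub_mean_le : ∀ᵐ x ∂P.law, |x i j - P.mean i j| ≤ 1 := by
  filter_upwards [P.ae_entry_mem i j] with x hx
  have h := P.mean_mem i j
  exact abs_le.2 ⟨by linarith [hx.1, h.2], by linarith [hx.2, h.1]⟩

end Problem

/-! ### Deviation inequalities for a fixed number of plays -/

namespace IsBCUCBRun

variable {L M : ℕ} {Ω : Type*} [mΩ : MeasurableSpace Ω] {μ : Measure Ω} {P : Problem L M}
  {oracle : (Fin M → Fin L → ℝ) → PMF (Finset (Fin L))} {T : ℕ}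
  {X : ℕ → Ω → Fin M → Fin L → ℝ} {A : ℕ → Ω → Finset (Fin L)}

/-- Bernstein's inequality for the first `s` plays of an arm. -/
lemma measure_bernstein [IsProbabilityMeasure μ] (h : IsBCUCBRun μ P oracle T X A)
    {ξ : (Fin M → Fin L → ℝ) → ℝ} (hξ : Measurable ξ) (hb : ∀ᵐ x ∂P.law, |ξ x| ≤ 1)
    (h0 : ∫ x, ξ x ∂P.law = 0) {σ u : ℝ} (hσ : 0 < σ) (hu : 0 < u)
    (hV : ∫ x, ξ x ^ 2 ∂P.law ≤ σ ^ 2) (j : Fin L) {t : ℕ} (ht : t ≤ T) (s : ℕ) :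
    μ {ω | count A t j ω = s ∧ s * (√6 * σ * u + u ^ 2)
        ≤ ∑ τ ∈ (Finset.Icc 1 t).filter (fun τ => j ∈ A τ ω), ξ (X τ ω)}
      ≤ ENNReal.ofReal (Real.exp (-(3 * (s * u ^ 2)))) := by
  have := P.law_isProbabilityMeasure
  obtain ⟨hR0, hR2, -⟩ := sqrt_six_bounds
  set R := √(6 : ℝ) with hR
  set w := R * u / σ with hw
  have hw0 : 0 < w := by positivity
  have hwσ : w * σ = R * u := by
    rw [hw]
    field_simp
  -- Bernstein's choice of the exponent: 1 - lam/3 = 1/(1 + w/3), and the Chernoff exponent becomes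
  -- exactly -3su².
  set lam := w / (1 + w / 3) with hlam
  have hl3 : lam < 3 := by
    rw [hlam, div_lt_iff₀ (by positivity)]
    linarith
  refine (h.measure_count_eq_and_le_sum hξ (by positivity)
    (lintegral_exp_le_of_abs_le_one hξ hb h0 hV (by positivity) hl3) j ht s _).trans (le_of_eq ?_)
  congr 2
  have h1 : 1 - lam / 3 = 1 / (1 + w / 3) := by
    rw [hlam]
    field_simp
    ring
  have h2 : u ^ 2 = (w * σ) ^ 2 / 6 := by rw [hwσ, mul_pow, hR2]; ring
  have h3 : R * σ * u = w * σ ^ 2 := by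
    rw [mul_right_comm, ← hwσ]
    ring
  rw [h1, h2, h3, hlam]
  field_simp
  ring

/-- The lower tail of the sum of a variable with values in `[0, 1]` over the first `s` plays of an
arm. -/
lemma measure_lower_tail [IsProbabilityMeasure μ] (h : IsBCUCBRun μ P oracle T X A)
    {Y : (Fin M → Fin L → ℝ) → ℝ} (hY : Measurable Y) (hb : ∀ᵐ x ∂P.law, 0 ≤ Y x ∧ Y x ≤ 1)
    {σ u : ℝ} (hσ : 0 < σ) (hu : 0 < u) (hV : ∫ x, Y x ∂P.law ≤ σ ^ 2) (j : Fin L) {t : ℕ}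
    (ht : t ≤ T) (s : ℕ) :
    μ {ω | count A t j ω = s ∧ s * (√6 * σ * u)
        ≤ ∑ τ ∈ (Finset.Icc 1 t).filter (fun τ => j ∈ A τ ω), (∫ x, Y x ∂P.law - Y (X τ ω))}
      ≤ ENNReal.ofReal (Real.exp (-(3 * (s * u ^ 2)))) := by
  have := P.law_isProbabilityMeasure
  obtain ⟨hR0, hR2, -⟩ := sqrt_six_bounds
  set R := √(6 : ℝ) with hR
  set w := R * u / σ with hw
  have hw0 : 0 < w := by positivity
  have hwσ : w * σ = R * u := by
    rw [hw]
    field_simp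
  -- The one-sided bound is purely sub-Gaussian, so the exponent w = √6u/σ is optimal and no u²
  -- correction is needed.
  refine (h.measure_count_eq_and_le_sum (ξ := fun x => ∫ y, Y y ∂P.law - Y x) (by fun_prop) hw0.le
    (lintegral_exp_mean_sub_le hY hb hV hw0.le) j ht s _).trans (le_of_eq ?_)
  congr 2
  have h2 : u ^ 2 = (w * σ) ^ 2 / 6 := by rw [hwσ, mul_pow, hR2]; ring
  have h3 : R * σ * u = w * σ ^ 2 := by
    rw [mul_right_comm, ← hwσ]
    ring
  rw [h2, h3]
  ring

lemma ae_feedback_mem (h : IsBCUCBRun μ P oracle T X A) {t : ℕ} (ht : t ≤ T) :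
    ∀ᵐ ω ∂μ, ∀ τ ∈ Finset.Icc 1 t, ∀ i, X τ ω i ∈ closedCube L := by
  rw [Filter.eventually_all_finset]
  intro τ hτ
  have hm := h.measurable_feedback_of_mem ht hτ
  have hτ' := Finset.mem_Icc.1 hτ
  have hlaw := h.feedback_law (τ - 1) (by omega)
  rw [Nat.sub_add_cancel hτ'.1] at hlaw
  have := P.law_mem
  rw [← hlaw] at this
  exact ae_of_ae_map hm.aemeasurable this

end IsBCUCBRun

/-- The index of an entry is an upper confidence bound within the Bernstein-type deviation. -/
def IsGoodIndex {L M : ℕ} {Ω : Type*} (P : Problem L M) (X : ℕ → Ω → Fin M → Fin L → ℝ)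
    (A : ℕ → Ω → Finset (Fin L)) (t : ℕ) (ω : Ω) (i : Fin M) (j : Fin L) : Prop :=
  P.mean i j ≤ ucbIndex X A t ω i j ∧
    ucbIndex X A t ω i j - P.mean i j
      ≤ 5 * √(P.mean i j * (1 - P.mean i j)) * √(Real.log ((t + 1 : ℕ) : ℝ) / count A t j ω)
        + 18 * √(Real.log ((t + 1 : ℕ) : ℝ) / count A t j ω) ^ 2

section Deviation

variable {L M : ℕ} {Ω : Type*} {P : Problem L M} {X : ℕ → Ω → Fin M → Fin L → ℝ}
  {A : ℕ → Ω → Finset (Fin L)}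

lemma empMean_mem {t : ℕ} {ω : Ω} (hX : ∀ τ ∈ Finset.Icc 1 t, ∀ i, X τ ω i ∈ closedCube L)
    (i : Fin M) (j : Fin L) : 0 ≤ empMean X A t i j ω ∧ empMean X A t i j ω ≤ 1 := by
  unfold empMean
  constructor
  · exact div_nonneg (Finset.sum_nonneg fun τ hτ =>
      (hX τ (Finset.mem_of_mem_filter τ hτ) i j).1) (Nat.cast_nonneg _)
  · refine div_le_one_of_le₀ ?_ (Nat.cast_nonneg _)
    refine (Finset.sum_le_card_nsmul _ _ 1 fun τ hτ =>
      (hX τ (Finset.mem_of_mem_filter τ hτ) i j).2).trans ?_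
    simp [count]

lemma empVar_le {t : ℕ} {ω : Ω} (hX : ∀ τ ∈ Finset.Icc 1 t, ∀ i, X τ ω i ∈ closedCube L)
    (i : Fin M) (j : Fin L) :
    empVar X A t i j ω ≤ empMean X A t i j ω * (1 - empMean X A t i j ω) := by
  have h : (∑ τ ∈ (Finset.Icc 1 t).filter (fun τ => j ∈ A τ ω), (X τ ω i j) ^ 2) / count A t j ω
      ≤ empMean X A t i j ω := by
    unfold empMean
    refine div_le_div_of_nonneg_right (Finset.sum_le_sum fun τ hτ => ?_) (Nat.cast_nonneg _)
    have := hX τ (Finset.mem_of_mem_filter τ hτ) i j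
    nlinarith [this.1, this.2]
  unfold empVar
  linarith

/-- An entry has a good index outside of the three deviation events. -/
lemma isGoodIndex_of_deviation {t s : ℕ} {ω : Ω}
    (hX : ∀ τ ∈ Finset.Icc 1 t, ∀ i, X τ ω i ∈ closedCube L) {i : Fin M} {j : Fin L}
    (hs : count A t j ω = s) (hs0 : 0 < s) {u σ : ℝ} (hu : 0 < u) (hσ : 0 < σ)
    (hus : u = √(Real.log ((t + 1 : ℕ) : ℝ) / s)) (hσv : σ ^ 2 = max (P.entryVar i j) (u ^ 2))
    (h1 : ∑ τ ∈ (Finset.Icc 1 t).filter (fun τ => j ∈ A τ ω), (X τ ω i j - P.mean i j)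
      < s * (√6 * σ * u + u ^ 2))
    (h2 : ∑ τ ∈ (Finset.Icc 1 t).filter (fun τ => j ∈ A τ ω), (P.mean i j - X τ ω i j)
      < s * (√6 * σ * u + u ^ 2))
    (h3 : ∑ τ ∈ (Finset.Icc 1 t).filter (fun τ => j ∈ A τ ω),
      (P.entryVar i j - (X τ ω i j - P.mean i j) ^ 2) < s * (√6 * σ * u)) :
    IsGoodIndex P X A t ω i j := by
  have hsR : (0 : ℝ) < s := by exact_mod_cast hs0
  have hcard : (((Finset.Icc 1 t).filter (fun τ => j ∈ A τ ω)).card : ℝ) = s := by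
    exact_mod_cast hs
  obtain ⟨hm0, hm1⟩ := empMean_mem (A := A) hX i j
  have hVle := empVar_le (A := A) hX i j
  obtain ⟨hp0, hp1⟩ := P.mean_mem i j
  set p := P.mean i j with hp
  set v := P.entryVar i j with hv
  have hS1 : ∑ τ ∈ (Finset.Icc 1 t).filter (fun τ => j ∈ A τ ω), X τ ω i j
      = s * empMean X A t i j ω := by
    unfold empMean
    rw [hs]
    field_simp
  have hS2 : ∑ τ ∈ (Finset.Icc 1 t).filter (fun τ => j ∈ A τ ω), X τ ω i j ^ 2
      = s * (empVar X A t i j ω + empMean X A t i j ω ^ 2) := by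
    unfold empVar
    rw [hs]
    field_simp
    ring
  set m := empMean X A t i j ω with hm
  set V := empVar X A t i j ω with hV
  rw [Finset.sum_sub_distrib, Finset.sum_const, nsmul_eq_mul, hcard, hS1, ← mul_sub] at h1
  rw [Finset.sum_sub_distrib, Finset.sum_const, nsmul_eq_mul, hcard, hS1, ← mul_sub] at h2
  have hsq : ∑ τ ∈ (Finset.Icc 1 t).filter (fun τ => j ∈ A τ ω), (X τ ω i j - p) ^ 2
      = s * (V + (m - p) ^ 2) := by
    simp_rw [sub_sq]
    rw [Finset.sum_add_distrib, Finset.sum_sub_distrib, hS2, ← Finset.sum_mul, ← Finset.mul_sum,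
      hS1, Finset.sum_const, nsmul_eq_mul, hcard]
    ring
  rw [Finset.sum_sub_distrib, Finset.sum_const, nsmul_eq_mul, hcard, hsq, ← mul_sub] at h3
  have h1' := (lt_of_mul_lt_mul_left h1 hsR.le).le
  have h2' := (lt_of_mul_lt_mul_left h2 hsR.le).le
  have h3' := (lt_of_mul_lt_mul_left h3 hsR.le).le
  have hu2 : u ^ 2 = Real.log ((t + 1 : ℕ) : ℝ) / s := by
    rw [hus, Real.sq_sqrt]
    exact div_nonneg (Real.log_natCast_nonneg _) hsR.le
  have hindex : ucbIndex X A t ω i j = min 1 (m + √(6 * V * u ^ 2) + 9 * u ^ 2) := by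
    unfold ucbIndex
    rw [hu2, hs, mul_div_assoc, mul_div_assoc]
  unfold IsGoodIndex
  rw [hindex, hs, ← hus]
  exact ⟨le_index_of_deviation hu hp1 hm0 (P.entryVar_le_quarter i j) hσ hσv h2' h3' rfl,
    index_sub_le_of_deviation hu hp0 hp1 hm0 hm1 (P.entryVar_le i j) hσ hσv h2' h1' hVle⟩

end Deviation

namespace IsBCUCBRun

variable {L M : ℕ} {Ω : Type*} [mΩ : MeasurableSpace Ω] {μ : Measure Ω} {P : Problem L M}
  {oracle : (Fin M → Fin L → ℝ) → PMF (Finset (Fin L))} {T : ℕ}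
  {X : ℕ → Ω → Fin M → Fin L → ℝ} {A : ℕ → Ω → Finset (Fin L)}

/-- The index of an entry fails to be good with probability at most `3 / (t + 1) ^ 2`. -/
lemma measure_not_isGoodIndex_le [IsProbabilityMeasure μ] (h : IsBCUCBRun μ P oracle T X A)
    (i : Fin M) (j : Fin L) {t : ℕ} (ht : t ≤ T) :
    μ {ω | count A t j ω ≠ 0 ∧ ¬ IsGoodIndex P X A t ω i j}
      ≤ ENNReal.ofReal (3 / ((t + 1 : ℕ) : ℝ) ^ 2) := by
  rcases Nat.eq_zero_or_pos t with rfl | ht0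
  · simp [count_zero]
  set l := Real.log ((t + 1 : ℕ) : ℝ) with hl
  have hl0 : 0 < l := Real.log_pos (by exact_mod_cast Nat.succ_lt_succ ht0)
  set u : ℕ → ℝ := fun s => √(l / s) with hu
  -- Raising the variance to at least u² keeps σ positive, since the Chernoff exponents divide by
  -- it; it also bounds the variance of the squared deviation, whose values lie in [0,1].
  set σ : ℕ → ℝ := fun s => √(max (P.entryVar i j) (u s ^ 2)) with hσ
  set E₁ : ℕ → Set Ω := fun s => {ω | count A t j ω = s ∧ s * (√6 * σ s * u s + u s ^ 2)
    ≤ ∑ τ ∈ (Finset.Icc 1 t).filter (fun τ => j ∈ A τ ω), (X τ ω i j - P.mean i j)} with hE₁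
  set E₂ : ℕ → Set Ω := fun s => {ω | count A t j ω = s ∧ s * (√6 * σ s * u s + u s ^ 2)
    ≤ ∑ τ ∈ (Finset.Icc 1 t).filter (fun τ => j ∈ A τ ω), (P.mean i j - X τ ω i j)} with hE₂
  set E₃ : ℕ → Set Ω := fun s => {ω | count A t j ω = s ∧ s * (√6 * σ s * u s)
    ≤ ∑ τ ∈ (Finset.Icc 1 t).filter (fun τ => j ∈ A τ ω),
      (P.entryVar i j - (X τ ω i j - P.mean i j) ^ 2)} with hE₃
  have hu0 : ∀ s, 0 < s → 0 < u s := fun s hs =>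
    Real.sqrt_pos.2 (div_pos hl0 (by exact_mod_cast hs))
  have hσ0 : ∀ s, 0 < s → 0 < σ s := fun s hs =>
    Real.sqrt_pos.2 (lt_max_of_lt_right (pow_pos (hu0 s hs) 2))
  have hσ2 : ∀ s, σ s ^ 2 = max (P.entryVar i j) (u s ^ 2) := fun s =>
    Real.sq_sqrt (le_max_of_le_right (sq_nonneg _))
  have hprob : ∀ s ∈ Finset.Icc 1 t, μ (E₁ s ∪ E₂ s ∪ E₃ s)
      ≤ ENNReal.ofReal (3 / ((t + 1 : ℕ) : ℝ) ^ 3) := by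
    intro s hs
    have hs0 : 0 < s := (Finset.mem_Icc.1 hs).1
    have hsR : (0 : ℝ) < s := by exact_mod_cast hs0
    have hv : ∫ x, (x i j - P.mean i j) ^ 2 ∂P.law ≤ σ s ^ 2 := by
      rw [hσ2]
      exact le_max_left _ _
    have b1 := h.measure_bernstein (ξ := fun x => x i j - P.mean i j) (by fun_prop)
      (P.ae_abs_sub_mean_le i j) (P.integral_sub_mean i j) (hσ0 s hs0) (hu0 s hs0) hv j ht s
    have b2 := h.measure_bernstein (ξ := fun x => P.mean i j - x i j) (by fun_prop)
      ((P.ae_abs_sub_mean_le i j).mono fun x hx => by rwa [abs_sub_comm])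
      (by simp_rw [← neg_sub (_ : ℝ) (P.mean i j)]; rw [integral_neg, P.integral_sub_mean, neg_zero])
      (hσ0 s hs0) (hu0 s hs0) (by simp_rw [← neg_sub (_ : ℝ) (P.mean i j), neg_sq]; exact hv) j ht s
    have b3 := h.measure_lower_tail (Y := fun x => (x i j - P.mean i j) ^ 2) (by fun_prop)
      ((P.ae_abs_sub_mean_le i j).mono fun x hx =>
        ⟨sq_nonneg _, (sq_le_one_iff_abs_le_one _).2 hx⟩)
      (hσ0 s hs0) (hu0 s hs0) hv j ht s
    -- The cube leaves a summable 1/(t+1)² after the union over the at most t values of the random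
    -- counter.
    have hexp : Real.exp (-(3 * (s * u s ^ 2))) = 1 / ((t + 1 : ℕ) : ℝ) ^ 3 := by
      have h1 : (s : ℝ) * u s ^ 2 = l := by
        rw [hu]
        dsimp only
        rw [Real.sq_sqrt (by positivity)]
        field_simp
      rw [h1, hl, Real.exp_neg, show (3 : ℝ) * Real.log ((t + 1 : ℕ) : ℝ)
        = ((3 : ℕ) : ℝ) * Real.log ((t + 1 : ℕ) : ℝ) by norm_num, Real.exp_nat_mul,
        Real.exp_log (by positivity), one_div]
    rw [hexp] at b1 b2 b3
    refine (measure_union_le _ _).trans ((add_le_add ((measure_union_le _ _).trans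
      (add_le_add b1 b2)) b3).trans (le_of_eq ?_))
    rw [← ENNReal.ofReal_add (by positivity) (by positivity),
      ← ENNReal.ofReal_add (by positivity) (by positivity)]
    congr 1
    ring
  have hsub : ∀ᵐ ω ∂μ, ω ∈ {ω | count A t j ω ≠ 0 ∧ ¬ IsGoodIndex P X A t ω i j} →
      ω ∈ ⋃ s ∈ Finset.Icc 1 t, (E₁ s ∪ E₂ s ∪ E₃ s) := by
    filter_upwards [h.ae_feedback_mem ht] with ω hX hω
    obtain ⟨hc, hbad⟩ := hω
    by_contra hcon
    simp only [Set.mem_iUnion, not_exists] at hcon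
    have hs0 : 0 < count A t j ω := Nat.pos_of_ne_zero hc
    have hn := hcon (count A t j ω) (Finset.mem_Icc.2 ⟨hs0, count_le A ω t j⟩)
    simp only [Set.mem_union, not_or] at hn
    refine hbad (isGoodIndex_of_deviation hX rfl hs0 (hu0 _ hs0) (hσ0 _ hs0) rfl (hσ2 _)
      (not_le.1 fun hle => hn.1.1 ⟨rfl, hle⟩) (not_le.1 fun hle => hn.1.2 ⟨rfl, hle⟩)
      (not_le.1 fun hle => hn.2 ⟨rfl, hle⟩))
  refine (measure_mono_ae hsub).trans ((measure_biUnion_finset_le _ _).trans ?_)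
  refine (Finset.sum_le_sum hprob).trans ?_
  rw [Finset.sum_const, Nat.card_Icc, Nat.add_sub_cancel, nsmul_eq_mul,
    ← ENNReal.ofReal_natCast t, ← ENNReal.ofReal_mul (by positivity)]
  refine ENNReal.ofReal_le_ofReal ?_
  rw [mul_div_assoc', div_le_div_iff₀ (by positivity) (by positivity)]
  push_cast
  have : (0 : ℝ) ≤ ((t : ℝ) + 1) ^ 2 := by positivity
  nlinarith

end IsBCUCBRun

/-! ### Rewards -/

lemma IsMonotonicGiniSmooth.gini_nonneg {L : ℕ} {𝒜 : Finset (Finset (Fin L))}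
    {f : Finset (Fin L) → (Fin L → ℝ) → ℝ} {γinf γg : ℝ}
    (hf : IsMonotonicGiniSmooth 𝒜 f γinf γg) (h𝒜 : 𝒜.Nonempty) : 0 ≤ γg := by
  obtain ⟨B, hB⟩ := h𝒜
  exact (Real.sqrt_nonneg _).trans (hf.gini_le B hB (fun _ => 1 / 2) fun _ => by norm_num)

/-- The projection of a parameter to the cube. -/
def clip {L M : ℕ} (x : Fin M → Fin L → ℝ) : Fin M → Fin L → ℝ := fun i j => max 0 (min 1 (x i j))

lemma clip_mem {L M : ℕ} (x : Fin M → Fin L → ℝ) (i : Fin M) : clip x i ∈ closedCube L := fun _ =>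
  ⟨le_max_left _ _, max_le zero_le_one (min_le_left _ _)⟩

lemma clip_eq_self {L M : ℕ} {x : Fin M → Fin L → ℝ} (hx : ∀ i, x i ∈ closedCube L) :
    clip x = x := by
  funext i j
  rw [clip, min_eq_right (hx i j).2, max_eq_right (hx i j).1]

namespace Problem

variable {L M : ℕ} (P : Problem L M) {γinf γg : ℝ}

lemma reward_nonneg {B : Finset (Fin L)} (hB : B ∈ P.actions) {x : Fin M → Fin L → ℝ}
    (hx : ∀ i, x i ∈ closedCube L) : 0 ≤ P.reward B x :=
  Finset.sum_nonneg fun i _ => mul_nonneg (P.weight_nonneg i) (P.rewardFn_nonneg i B hB _ (hx i))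

lemma reward_le_optValue {B : Finset (Fin L)} (hB : B ∈ P.actions) (x : Fin M → Fin L → ℝ) :
    P.reward B x ≤ P.optValue x :=
  Finset.le_sup' (fun B => P.reward B x) hB

lemma optValue_mean_nonneg : 0 ≤ P.optValue P.mean := by
  obtain ⟨B, hB⟩ := P.actions_nonempty
  exact (P.reward_nonneg hB P.mean_mem_closedCube).trans (P.reward_le_optValue hB _)

lemma gap_le_maxGap {B : Finset (Fin L)} (hB : B ∈ P.actions) (α : ℝ) : P.gap α B ≤ P.maxGap α :=
  (le_max_left _ _).trans (Finset.le_sup' (fun B => max (P.gap α B) 0) hB)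

lemma maxGap_nonneg (α : ℝ) : 0 ≤ P.maxGap α := by
  obtain ⟨B, hB⟩ := P.actions_nonempty
  exact (le_max_right _ _).trans (Finset.le_sup' (fun B => max (P.gap α B) 0) hB)

lemma totalWeight_nonneg : 0 ≤ P.totalWeight := Finset.sum_nonneg fun i _ => P.weight_nonneg i

/-- Outside the cube nothing is assumed about the reward functions, and the indices lie in it only
almost surely. Clipping makes the reward continuous everywhere without changing it almost surely. -/
lemma measurable_reward_clip (hsmooth : ∀ i, IsMonotonicGiniSmooth P.actions (P.rewardFn i) γinf γg)
    {B : Finset (Fin L)} (hB : B ∈ P.actions) : Measurable fun x => P.reward B (clip x) := by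
  have : Continuous fun x : Fin M → Fin L → ℝ => P.reward B (clip x) := by
    unfold reward
    refine continuous_finsetSum _ fun i _ => continuous_const.mul ?_
    refine ((hsmooth i).continuousOn B hB).comp_continuous ?_ fun x => clip_mem x i
    unfold clip
    fun_prop
  exact this.measurable

lemma measurable_optValue_clip
    (hsmooth : ∀ i, IsMonotonicGiniSmooth P.actions (P.rewardFn i) γinf γg) :
    Measurable fun x => P.optValue (clip x) := by
  have := Finset.measurable_sup' P.actions_nonempty
    fun B hB => P.measurable_reward_clip hsmooth hB
  convert this using 1
  funext x
  simp [optValue, Finset.sup'_apply]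

/-- The gap of a batch that is approximately optimal for upper confidence bounds. -/
lemma gap_le_of_index (hsmooth : ∀ i, IsMonotonicGiniSmooth P.actions (P.rewardFn i) γinf γg)
    {α : ℝ} (hα : 0 ≤ α) {q : Fin M → Fin L → ℝ} (hq : ∀ i, q i ∈ closedCube L)
    {u : Fin L → ℝ} (hu : ∀ j, 0 ≤ u j) (hle : ∀ i j, P.mean i j ≤ q i j)
    (hdev : ∀ i j, q i j - P.mean i j
      ≤ 5 * √(P.mean i j * (1 - P.mean i j)) * u j + 18 * u j ^ 2)
    {B : Finset (Fin L)} (hB : B ∈ P.actions) (hopt : α * P.optValue q ≤ P.reward B q) :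
    P.gap α B ≤ 24 * γg * P.totalWeight * √(∑ j ∈ B, u j ^ 2) := by
  have hsm := fun i (C : Finset (Fin L)) (hC : C ∈ P.actions) =>
    (hsmooth i).mono_and_sub_le hC (P.mean_mem_closedCube i) (hq i) hu (hle i) (hdev i)
      ((hsmooth i).gini_nonneg P.actions_nonempty)
  have hoptle : P.optValue P.mean ≤ P.optValue q := by
    refine Finset.sup'_le _ _ fun C hC => ?_
    refine le_trans ?_ (P.reward_le_optValue hC q)
    exact Finset.sum_le_sum fun i _ =>
      mul_le_mul_of_nonneg_left (hsm i C hC).1 (P.weight_nonneg i)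
  have hdiff : P.reward B q - P.reward B P.mean
      ≤ 24 * γg * P.totalWeight * √(∑ j ∈ B, u j ^ 2) := by
    unfold reward totalWeight
    rw [← Finset.sum_sub_distrib, Finset.mul_sum, Finset.sum_mul]
    refine Finset.sum_le_sum fun i _ => ?_
    have := mul_le_mul_of_nonneg_left (hsm i B hB).2 (P.weight_nonneg i)
    linarith
  have := mul_le_mul_of_nonneg_left hoptle hα
  unfold gap
  linarith

end Problem

lemma ucbIndex_mem {L M : ℕ} {Ω : Type*} {X : ℕ → Ω → Fin M → Fin L → ℝ}
    {A : ℕ → Ω → Finset (Fin L)} {t : ℕ} {ω : Ω}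
    (hX : ∀ τ ∈ Finset.Icc 1 t, ∀ i, X τ ω i ∈ closedCube L) (i : Fin M) :
    ucbIndex X A t ω i ∈ closedCube L := by
  intro j
  refine ⟨le_min zero_le_one ?_, min_le_left _ _⟩
  have h1 := (empMean_mem (A := A) hX i j).1
  have h2 := Real.log_natCast_nonneg (t + 1)
  positivity

/-! ### Conditional success of the oracle -/

namespace IsBCUCBRun

variable {L M : ℕ} {Ω : Type*} [mΩ : MeasurableSpace Ω] {μ : Measure Ω} {P : Problem L M}
  {oracle : (Fin M → Fin L → ℝ) → PMF (Finset (Fin L))} {T : ℕ}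
  {X : ℕ → Ω → Fin M → Fin L → ℝ} {A : ℕ → Ω → Finset (Fin L)} {γinf γg α β : ℝ}

/-- In a history event in which the oracle is called, it succeeds with conditional probability at
least `β`. -/
lemma oracle_success [IsProbabilityMeasure μ] (h : IsBCUCBRun μ P oracle T X A)
    (hsmooth : ∀ i, IsMonotonicGiniSmooth P.actions (P.rewardFn i) γinf γg)
    (horacle : P.IsApproxOracle oracle α β) {t : ℕ} (ht : t < T) {Q : Set Ω}
    (hQ : MeasurableSet[history X A t] Q) (hQc : ∀ ω ∈ Q, ∀ j, count A t j ω ≠ 0) :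
    MeasurableSet (Q ∩ {ω | A (t + 1) ω ∈ P.actions ∧ α * P.optValue (clip (ucbIndex X A t ω))
        ≤ P.reward (A (t + 1) ω) (clip (ucbIndex X A t ω))}) ∧
      β * μ.real Q ≤ μ.real (Q ∩ {ω | A (t + 1) ω ∈ P.actions ∧
        α * P.optValue (clip (ucbIndex X A t ω))
          ≤ P.reward (A (t + 1) ω) (clip (ucbIndex X A t ω))}) := by
  classical
  have hle := h.history_le ht.le
  set S : Finset (Fin L) → Set Ω := fun B => {ω | α * P.optValue (clip (ucbIndex X A t ω))
    ≤ P.reward B (clip (ucbIndex X A t ω))} with hS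
  set E : Finset (Fin L) → Set Ω := fun B => {ω | A (t + 1) ω = B} with hE
  have hEm : ∀ B, MeasurableSet (E B) := h.measurable_batch t ht
  have hSm : ∀ B ∈ P.actions, MeasurableSet[history X A t] (S B) := fun B hB =>
    measurableSet_le
      (((P.measurable_optValue_clip hsmooth).comp (measurable_ucbIndex_history X A t)).const_mul α)
      ((P.measurable_reward_clip hsmooth hB).comp (measurable_ucbIndex_history X A t))
  have hQ0 := hle _ hQ
  have hunion : Q ∩ {ω | A (t + 1) ω ∈ P.actions ∧
      α * P.optValue (clip (ucbIndex X A t ω)) ≤ P.reward (A (t + 1) ω) (clip (ucbIndex X A t ω))}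
      = ⋃ B ∈ P.actions, (Q ∩ S B ∩ E B) := by
    ext ω
    simp only [Set.mem_inter_iff, Set.mem_ofPred_eq, Set.mem_iUnion, exists_prop, hS, hE]
    constructor
    · rintro ⟨h1, h2, h3⟩
      exact ⟨_, h2, ⟨h1, h3⟩, rfl⟩
    · rintro ⟨B, h2, ⟨h1, h3⟩, rfl⟩
      exact ⟨h1, h2, h3⟩
  rw [hunion]
  refine ⟨MeasurableSet.biUnion P.actions.countable_toSet fun B hB =>
    (hQ0.inter (hle _ (hSm B hB))).inter (hEm B), ?_⟩
  rw [measureReal_biUnion_finset (fun B _ C _ hBC => by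
      refine Set.disjoint_left.2 fun ω h1 h2 => hBC ?_
      exact h1.2.symm.trans h2.2)
    (fun B hB => ((hQ0.inter (hle _ (hSm B hB))).inter (hEm B)))]
  -- Once a batch B is fixed, its approximate optimality is a history event; only the choice of B is
  -- random given the past.
  have hB : ∀ B ∈ P.actions, μ.real (Q ∩ S B ∩ E B)
      = ∫ ω in Q, (S B).indicator (μ⟦E B | history X A t⟧) ω ∂μ := by
    intro B hB
    rw [setIntegral_indicator (hle _ (hSm B hB)), setIntegral_condExp hle
      ((integrable_const (1 : ℝ)).indicator (hEm B)) (hQ.inter (hSm B hB)),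
      setIntegral_indicator (hEm B)]
    simp
  have hint : ∀ B ∈ P.actions, Integrable
      (fun ω => (S B).indicator (μ⟦E B | history X A t⟧) ω) (μ.restrict Q) := fun B hB =>
    ((integrable_condExp (f := (E B).indicator fun _ => (1 : ℝ))).indicator
      (hle _ (hSm B hB))).integrableOn
  rw [Finset.sum_congr rfl hB, ← integral_finsetSum _ hint]
  have hconst : β * μ.real Q = ∫ _ in Q, β ∂μ := by
    simp [mul_comm]
  rw [hconst]
  refine setIntegral_mono_on_ae (integrable_const _).integrableOn
    (integrable_finsetSum _ hint) hQ0 ?_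
  have hround : ∀ᵐ ω ∂μ, ∀ B, (∀ j, count A t j ω ≠ 0) →
      (μ⟦{ω' | A (t + 1) ω' = B} | history X A t⟧) ω = (oracle (ucbIndex X A t ω) B).toReal :=
    ae_all_iff.2 fun B => h.oracle_round t ht B
  filter_upwards [hround, h.ae_feedback_mem ht.le] with ω hω hX hωQ
  have hmem := ucbIndex_mem (A := A) hX
  have ho := (horacle _ hmem).2
  have hclip := clip_eq_self hmem
  have hsum : ∑ B ∈ P.actions, (S B).indicator (μ⟦E B | history X A t⟧) ω
      = ∑ B ∈ P.actions.filter (fun B => α * P.optValue (ucbIndex X A t ω)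
        ≤ P.reward B (ucbIndex X A t ω)), (oracle (ucbIndex X A t ω) B).toReal := by
    rw [Finset.sum_filter]
    refine Finset.sum_congr rfl fun B _ => ?_
    rw [Set.indicator_apply]
    simp only [hS, hE, Set.mem_ofPred_eq, hclip, hω B (hQc ω hωQ)]
  rw [hsum]
  have hset : {B | B ∈ P.actions ∧ α * P.optValue (ucbIndex X A t ω)
      ≤ P.reward B (ucbIndex X A t ω)} = ((P.actions.filter (fun B =>
        α * P.optValue (ucbIndex X A t ω) ≤ P.reward B (ucbIndex X A t ω)) :
          Finset (Finset (Fin L))) : Set (Finset (Fin L))) := by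
    ext B
    simp
  rw [hset, PMF.toOuterMeasure_apply_finset] at ho
  rw [← ENNReal.toReal_sum fun B _ => PMF.apply_ne_top _ _]
  exact (ENNReal.ofReal_le_iff_le_toReal
    (ENNReal.sum_ne_top.2 fun B _ => PMF.apply_ne_top _ _)).1 ho

end IsBCUCBRun

section Events

variable {L M : ℕ} {Ω : Type*} {P : Problem L M} {X : ℕ → Ω → Fin M → Fin L → ℝ}
  {A : ℕ → Ω → Finset (Fin L)}

lemma measurableSet_isGoodIndex (t : ℕ) :
    MeasurableSet[history X A t] {ω | ∀ i j, IsGoodIndex P X A t ω i j} := by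
  have hq : ∀ i j, Measurable[history X A t] fun ω => ucbIndex X A t ω i j := fun i j =>
    (measurable_pi_apply j).comp ((measurable_pi_apply i).comp (measurable_ucbIndex_history X A t))
  have hu : ∀ j, Measurable[history X A t]
      fun ω => √(Real.log ((t + 1 : ℕ) : ℝ) / count A t j ω) := fun j =>
    (measurable_const.div (measurable_count_history X A t j)).sqrt
  simp only [Set.ofPred_forall]
  refine MeasurableSet.iInter fun i => MeasurableSet.iInter fun j => ?_
  refine MeasurableSet.inter (measurableSet_le measurable_const (hq i j)) ?_
  exact measurableSet_le ((hq i j).sub measurable_const)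
    (((hu j).const_mul _).add (((hu j).pow_const 2).const_mul _))

lemma measurableSet_count_ne_zero (t : ℕ) :
    MeasurableSet[history X A t] {ω | ∀ j, count A t j ω ≠ 0} := by
  have : {ω | ∀ j, count A t j ω ≠ 0} = ⋂ j, ((fun ω => (count A t j ω : ℝ)) ⁻¹' {0}ᶜ) := by
    ext ω
    simp
  rw [this]
  exact MeasurableSet.iInter fun j =>
    measurable_count_history X A t j (measurableSet_singleton 0).compl

lemma sum_batch_mem {t : ℕ} (ω : Ω) {f : ℕ → ℝ} (hf : ∀ s, 0 ≤ f s ∧ f s ≤ 1) :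
    0 ≤ ∑ j ∈ A (t + 1) ω, f (count A t j ω) ∧ ∑ j ∈ A (t + 1) ω, f (count A t j ω) ≤ L := by
  refine ⟨Finset.sum_nonneg fun j _ => (hf _).1, ?_⟩
  refine (Finset.sum_le_card_nsmul _ _ 1 fun j _ => (hf _).2).trans ?_
  rw [nsmul_eq_mul, mul_one]
  exact_mod_cast (Finset.card_le_univ _).trans (by simp)

end Events

/-! ### Regret of one round and of the whole run -/

namespace IsBCUCBRun

variable {L M : ℕ} {Ω : Type*} [mΩ : MeasurableSpace Ω] {μ : Measure Ω} {P : Problem L M}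
  {oracle : (Fin M → Fin L → ℝ) → PMF (Finset (Fin L))} {T : ℕ}
  {X : ℕ → Ω → Fin M → Fin L → ℝ} {A : ℕ → Ω → Finset (Fin L)} {γinf γg α β : ℝ}

/-- A sum of a function of the counters over the batch of a round is measurable. -/
lemma measurable_sum_batch (h : IsBCUCBRun μ P oracle T X A) {t : ℕ} (ht : t < T) (f : ℕ → ℝ) :
    Measurable fun ω => ∑ j ∈ A (t + 1) ω, f (count A t j ω) := by
  have h1 : ∀ j, Measurable fun ω => f (count A t j ω) := by
    intro j
    have hc : Measurable fun ω => ⌊(count A t j ω : ℝ)⌋₊ :=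
      Nat.measurable_floor.comp ((measurable_count_history X A t j).mono (h.history_le ht.le) le_rfl)
    simp only [Nat.floor_natCast] at hc
    exact (measurable_from_top (f := f)).comp hc
  have h2 : (fun ω => ∑ j ∈ A (t + 1) ω, f (count A t j ω))
      = fun ω => ∑ j, if j ∈ A (t + 1) ω then f (count A t j ω) else 0 := by
    funext ω
    rw [← Finset.sum_filter]
    simp
  rw [h2]
  refine Finset.measurable_sum _ fun j _ => Measurable.ite ?_ (h1 j) measurable_const
  exact h.history_le (Nat.succ_le_of_lt ht) _
    (measurableSet_mem_batch_history X A (t := t + 1) (by simp) j)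

lemma integrable_sum_batch [IsFiniteMeasure μ] (h : IsBCUCBRun μ P oracle T X A) {t : ℕ}
    (ht : t < T) {f : ℕ → ℝ} (hf : ∀ s, 0 ≤ f s ∧ f s ≤ 1) :
    Integrable (fun ω => ∑ j ∈ A (t + 1) ω, f (count A t j ω)) μ := by
  refine Integrable.of_bound (h.measurable_sum_batch ht f).aestronglyMeasurable L
    (.of_forall fun ω => ?_)
  rw [Real.norm_eq_abs, abs_of_nonneg (sum_batch_mem ω hf).1]
  exact (sum_batch_mem ω hf).2

lemma integrable_sqrt_sum_batch [IsFiniteMeasure μ] (h : IsBCUCBRun μ P oracle T X A) {t : ℕ}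
    (ht : t < T) {f : ℕ → ℝ} (hf : ∀ s, 0 ≤ f s ∧ f s ≤ 1) :
    Integrable (fun ω => √(∑ j ∈ A (t + 1) ω, f (count A t j ω))) μ := by
  refine Integrable.of_bound (h.measurable_sum_batch ht f).sqrt.aestronglyMeasurable (√L)
    (.of_forall fun ω => ?_)
  rw [Real.norm_eq_abs, abs_of_nonneg (Real.sqrt_nonneg _)]
  exact Real.sqrt_le_sqrt (sum_batch_mem ω hf).2

lemma integrable_reward [IsFiniteMeasure μ] (h : IsBCUCBRun μ P oracle T X A) {t : ℕ}
    (ht : t < T) (x : Fin M → Fin L → ℝ) : Integrable (fun ω => P.reward (A (t + 1) ω) x) μ := by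
  have hm : Measurable fun ω => P.reward (A (t + 1) ω) x :=
    (measurable_from_top (f := fun B => P.reward B x)).comp
      (h.measurable_batch_of_mem (Nat.succ_le_of_lt ht) (by simp : t + 1 ∈ Finset.Icc 1 (t + 1)))
  refine Integrable.of_bound hm.aestronglyMeasurable (∑ B, |P.reward B x|) (.of_forall fun ω => ?_)
  exact Finset.single_le_sum (f := fun B => |P.reward B x|) (fun _ _ => abs_nonneg _)
    (Finset.mem_univ (A (t + 1) ω))

/-- The expected regret of a round. -/
lemma round_regret_le [IsProbabilityMeasure μ] (h : IsBCUCBRun μ P oracle T X A)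
    (hsmooth : ∀ i, IsMonotonicGiniSmooth P.actions (P.rewardFn i) γinf γg)
    (hα : 0 ≤ α) (hβ : β ≤ 1) (horacle : P.IsApproxOracle oracle α β)
    (hγ : 0 ≤ γg * P.totalWeight) {t : ℕ} (ht : t < T) :
    α * β * P.optValue P.mean - ∫ ω, P.reward (A (t + 1) ω) P.mean ∂μ
      ≤ ∫ ω, (P.maxGap α * ∑ j ∈ A (t + 1) ω, (if count A t j ω = 0 then 1 else 0)
          + 24 * (γg * P.totalWeight) * √(Real.log T) *
            √(∑ j ∈ A (t + 1) ω, 1 / (count A t j ω : ℝ))) ∂μ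
        + P.maxGap α * (M * L * (3 / ((t + 1 : ℕ) : ℝ) ^ 2)) := by
  have hle := h.history_le ht.le
  set a := α * P.optValue P.mean with ha
  have ha0 : 0 ≤ a := mul_nonneg hα P.optValue_mean_nonneg
  have hG := P.maxGap_nonneg α
  set G := P.maxGap α with hGdef
  set I : Set Ω := {ω | ∀ j, count A t j ω ≠ 0} with hI
  set E : Set Ω := {ω | ∀ i j, IsGoodIndex P X A t ω i j} with hE
  set S : Set Ω := {ω | A (t + 1) ω ∈ P.actions ∧
      α * P.optValue (clip (ucbIndex X A t ω)) ≤ P.reward (A (t + 1) ω) (clip (ucbIndex X A t ω))}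
    with hS
  have hIm : MeasurableSet[history X A t] I := measurableSet_count_ne_zero t
  have hEm : MeasurableSet[history X A t] E := measurableSet_isGoodIndex t
  have hI0 := hle _ hIm
  have hE0 := hle _ hEm
  set Q := I ∩ E with hQ
  have hQ0 : MeasurableSet Q := hI0.inter hE0
  set f₀ : ℕ → ℝ := fun s => if s = 0 then 1 else 0 with hf₀
  have hf₀b : ∀ s, 0 ≤ f₀ s ∧ f₀ s ≤ 1 := fun s => by
    simp only [hf₀]
    split_ifs <;> norm_num
  set f₁ : ℕ → ℝ := fun s => 1 / (s : ℝ) with hf₁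
  have hf₁b : ∀ s, 0 ≤ f₁ s ∧ f₁ s ≤ 1 := fun s => by
    refine ⟨by positivity, ?_⟩
    rcases Nat.eq_zero_or_pos s with rfl | hs
    · simp [hf₁]
    · exact (div_le_one (by exact_mod_cast hs)).2 (by exact_mod_cast hs)
  set c := 24 * (γg * P.totalWeight) * √(Real.log T) with hc
  have hc0 : 0 ≤ c := by positivity
  set R : Ω → ℝ := fun ω => c * √(∑ j ∈ A (t + 1) ω, f₁ (count A t j ω)) with hR
  set N : Ω → ℝ := fun ω => G * ∑ j ∈ A (t + 1) ω, f₀ (count A t j ω) with hN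
  have hRint : Integrable R μ := (h.integrable_sqrt_sum_batch ht hf₁b).const_mul c
  have hNint : Integrable N μ := (h.integrable_sum_batch ht hf₀b).const_mul G
  have hrint := h.integrable_reward ht P.mean
  obtain ⟨hQSm, hsucc⟩ := h.oracle_success hsmooth horacle ht (hIm.inter hEm) fun ω hω => hω.1
  change MeasurableSet (Q ∩ S) at hQSm
  change β * μ.real Q ≤ μ.real (Q ∩ S) at hsucc
  have hbad : μ.real (I ∩ Eᶜ) ≤ M * L * (3 / ((t + 1 : ℕ) : ℝ) ^ 2) := by
    have hsub : I ∩ Eᶜ ⊆ ⋃ i : Fin M, ⋃ j : Fin L,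
        {ω | count A t j ω ≠ 0 ∧ ¬ IsGoodIndex P X A t ω i j} := by
      rintro ω ⟨h1, h2⟩
      simp only [hE, Set.mem_compl_iff, Set.mem_ofPred_eq, not_forall] at h2
      obtain ⟨i, j, hij⟩ := h2
      exact Set.mem_iUnion₂.2 ⟨i, j, h1 j, hij⟩
    refine (measureReal_mono hsub).trans ((measureReal_iUnion_fintype_le _).trans ?_)
    calc ∑ i : Fin M, μ.real (⋃ j : Fin L, {ω | count A t j ω ≠ 0 ∧ ¬ IsGoodIndex P X A t ω i j})
        ≤ ∑ _i : Fin M, ∑ _j : Fin L, (3 / ((t + 1 : ℕ) : ℝ) ^ 2) := by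
          refine Finset.sum_le_sum fun i _ => (measureReal_iUnion_fintype_le _).trans ?_
          refine Finset.sum_le_sum fun j _ => ?_
          exact ENNReal.toReal_le_of_le_ofReal (by positivity)
            (h.measure_not_isGoodIndex_le i j ht.le)
      _ = _ := by
          simp
          ring
  -- The benchmark is redistributed: aβ off Q, the full a on successes in Q, and 0 on failures in Q,
  -- where nonnegativity of the reward suffices. Its mean is at least aβ because P(Q ∩ S) ≥ βP(Q).
  have hpoint : ∀ᵐ ω ∂μ, Qᶜ.indicator (fun _ => a * β) ω + (Q ∩ S).indicator (fun _ => a) ω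
      - P.reward (A (t + 1) ω) P.mean ≤ N ω + R ω + (I ∩ Eᶜ).indicator (fun _ => G) ω := by
    filter_upwards [h.batch_mem t ht, h.init_round t ht, h.ae_feedback_mem ht.le]
      with ω hmem hinit hX
    have hr0 := P.reward_nonneg hmem P.mean_mem_closedCube
    have hgap : a - P.reward (A (t + 1) ω) P.mean ≤ G := P.gap_le_maxGap hmem α
    have haβ : a * β ≤ a := mul_le_of_le_one_right ha0 hβ
    have hN0 : 0 ≤ N ω := mul_nonneg hG (sum_batch_mem ω hf₀b).1
    have hR0 : 0 ≤ R ω := mul_nonneg hc0 (Real.sqrt_nonneg _)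
    by_cases hωI : ω ∈ I
    swap
    · have hωQ : ω ∉ Q := fun hq => hωI hq.1
      rw [Set.indicator_of_mem (show ω ∈ Qᶜ from hωQ), Set.indicator_of_notMem fun hq => hωQ hq.1,
        Set.indicator_of_notMem fun hq => hωI hq.1]
      have hex : ∃ j, count A t j ω = 0 := by
        simpa [hI] using hωI
      obtain ⟨j, hj0, hjA⟩ := hinit hex
      have h1 : (1 : ℝ) ≤ ∑ j ∈ A (t + 1) ω, f₀ (count A t j ω) := by
        refine le_trans ?_ (Finset.single_le_sum (f := fun j => f₀ (count A t j ω))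
          (fun k _ => (hf₀b _).1) hjA)
        simp [hf₀, hj0]
      have h2 : G ≤ N ω := le_mul_of_one_le_right hG h1
      linarith
    by_cases hωE : ω ∈ E
    swap
    · have hωQ : ω ∉ Q := fun hq => hωE hq.2
      rw [Set.indicator_of_mem (show ω ∈ Qᶜ from hωQ), Set.indicator_of_notMem fun hq => hωQ hq.1,
        Set.indicator_of_mem (show ω ∈ I ∩ Eᶜ from ⟨hωI, hωE⟩)]
      linarith
    have hωQ : ω ∈ Q := ⟨hωI, hωE⟩
    rw [Set.indicator_of_notMem (fun hq : ω ∈ Qᶜ => hq hωQ),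
      Set.indicator_of_notMem fun hq : ω ∈ I ∩ Eᶜ => hq.2 hωE]
    by_cases hωS : ω ∈ S
    swap
    · rw [Set.indicator_of_notMem fun hq => hωS hq.2]
      linarith
    rw [Set.indicator_of_mem (show ω ∈ Q ∩ S from ⟨hωQ, hωS⟩)]
    have hcube := ucbIndex_mem (A := A) hX
    have hopt := hωS.2
    rw [clip_eq_self hcube] at hopt
    have hg := P.gap_le_of_index hsmooth hα hcube
      (u := fun j => √(Real.log ((t + 1 : ℕ) : ℝ) / count A t j ω)) (fun j => Real.sqrt_nonneg _)
      (fun i j => (hωE i j).1) (fun i j => (hωE i j).2) hmem hopt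
    have hlog : Real.log ((t + 1 : ℕ) : ℝ) ≤ Real.log T :=
      Real.log_le_log (by positivity) (by exact_mod_cast ht)
    have hrad : √(∑ j ∈ A (t + 1) ω, √(Real.log ((t + 1 : ℕ) : ℝ) / count A t j ω) ^ 2)
        ≤ √(Real.log T) * √(∑ j ∈ A (t + 1) ω, f₁ (count A t j ω)) := by
      rw [← Real.sqrt_mul (Real.log_natCast_nonneg _), Finset.mul_sum]
      refine Real.sqrt_le_sqrt (Finset.sum_le_sum fun j _ => ?_)
      rw [Real.sq_sqrt (div_nonneg (Real.log_natCast_nonneg _) (Nat.cast_nonneg _)),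
        div_eq_mul_one_div]
      exact mul_le_mul_of_nonneg_right hlog (hf₁b _).1
    have hfin : P.gap α (A (t + 1) ω) ≤ R ω := by
      refine hg.trans ?_
      have := mul_le_mul_of_nonneg_left hrad (by positivity : 0 ≤ 24 * (γg * P.totalWeight))
      simp only [hR, hc]
      linarith
    change a - P.reward (A (t + 1) ω) P.mean ≤ R ω at hfin
    linarith
  have hi1 : Integrable (Qᶜ.indicator fun _ => a * β) μ :=
    (integrable_const _).indicator hQ0.compl
  have hi2 : Integrable ((Q ∩ S).indicator fun _ => a) μ := (integrable_const _).indicator hQSm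
  have hi3 : Integrable ((I ∩ Eᶜ).indicator fun _ => G) μ :=
    (integrable_const _).indicator (hI0.inter hE0.compl)
  have hi12 : Integrable (fun ω => Qᶜ.indicator (fun _ => a * β) ω
    + (Q ∩ S).indicator (fun _ => a) ω) μ := hi1.add hi2
  have hiNR : Integrable (fun ω => N ω + R ω) μ := hNint.add hRint
  have hmono := integral_mono_ae (hi12.sub hrint) (hiNR.add hi3) hpoint
  simp only [Pi.sub_apply, Pi.add_apply] at hmono
  rw [integral_sub hi12 hrint, integral_add hi1 hi2, integral_add hiNR hi3,
    integral_indicator_const _ hQ0.compl, integral_indicator_const _ hQSm,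
    integral_indicator_const _ (hI0.inter hE0.compl), smul_eq_mul, smul_eq_mul, smul_eq_mul,
    probReal_compl_eq_one_sub hQ0] at hmono
  have h1 := mul_le_mul_of_nonneg_left hsucc ha0
  have h2 := mul_le_mul_of_nonneg_left hbad hG
  have h3 : α * β * P.optValue P.mean = a * β := by
    rw [ha]
    ring
  rw [h3]
  change a * β - ∫ ω, P.reward (A (t + 1) ω) P.mean ∂μ ≤ ∫ ω, (N ω + R ω) ∂μ + _
  linarith

/-- The regret of BC-UCB before its constants are simplified. -/
lemma regret_le [IsProbabilityMeasure μ] (h : IsBCUCBRun μ P oracle T X A) {K : ℕ} (hK : 1 ≤ K)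
    (hT : 1 ≤ T) (hcard : ∀ B ∈ P.actions, B.card ≤ K)
    (hsmooth : ∀ i, IsMonotonicGiniSmooth P.actions (P.rewardFn i) γinf γg)
    (hα : 0 ≤ α) (hβ : β ≤ 1) (horacle : P.IsApproxOracle oracle α β)
    (hγ : 0 ≤ γg * P.totalWeight) :
    regret μ P α β A T
      ≤ 24 * (γg * P.totalWeight) * √(Real.log T) * ((3 + √(1 + Real.log K)) * √(L * T))
        + L * P.maxGap α * (1 + M * (Real.pi ^ 2 / 2)) := by
  have hG := P.maxGap_nonneg α
  set G := P.maxGap α with hGdef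
  set c := 24 * (γg * P.totalWeight) * √(Real.log T) with hc
  have hc0 : 0 ≤ c := by positivity
  set F : ℕ → Ω → ℝ := fun t ω =>
    G * ∑ j ∈ A (t + 1) ω, (if count A t j ω = 0 then 1 else 0)
      + c * √(∑ j ∈ A (t + 1) ω, 1 / (count A t j ω : ℝ)) with hF
  have hFint : ∀ t ∈ Finset.range T, Integrable (F t) μ := by
    intro t ht
    have ht := Finset.mem_range.1 ht
    refine Integrable.add (Integrable.const_mul ?_ _) (Integrable.const_mul ?_ _)
    · refine h.integrable_sum_batch ht (f := fun s => if s = 0 then 1 else 0) fun s => ?_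
      split_ifs <;> norm_num
    · refine h.integrable_sqrt_sum_batch ht (f := fun s => 1 / (s : ℝ)) fun s =>
        ⟨by positivity, ?_⟩
      rcases Nat.eq_zero_or_pos s with rfl | hs
      · simp
      · exact (div_le_one (by exact_mod_cast hs)).2 (by exact_mod_cast hs)
  have hcards : ∀ᵐ ω ∂μ, ∀ t ∈ Finset.range T, (A (t + 1) ω).card ≤ K := by
    rw [Filter.eventually_all_finset]
    intro t ht
    filter_upwards [h.batch_mem t (Finset.mem_range.1 ht)] with ω hω
    exact hcard _ hω
  have hsumF : ∫ ω, ∑ t ∈ Finset.range T, F t ω ∂μ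
      ≤ G * L + c * ((3 + √(1 + Real.log K)) * √(L * T)) := by
    have h1 : ∀ᵐ ω ∂μ, ∑ t ∈ Finset.range T, F t ω
        ≤ G * L + c * ((3 + √(1 + Real.log K)) * √(L * T)) := by
      filter_upwards [hcards] with ω hω
      rw [Finset.sum_add_distrib, ← Finset.mul_sum, ← Finset.mul_sum]
      refine add_le_add (mul_le_mul_of_nonneg_left ?_ hG) (mul_le_mul_of_nonneg_left ?_ hc0)
      -- Each arm is played for the first time at most once, so initialisation costs at most L
      -- maximal gaps.
      · refine (sum_sum_mem_le A ω (f := fun s => if s = 0 then 1 else 0) (F := 1) (fun n => ?_)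
          T).trans (by simp)
        rw [Finset.sum_ite_eq' (Finset.range n) 0 fun _ => (1 : ℝ)]
        split_ifs <;> norm_num
      · exact sum_sqrt_sum_inv_count_le A ω hK hT fun t ht => hω t (Finset.mem_range.2 ht)
    refine (integral_mono_ae (integrable_finsetSum _ hFint) (integrable_const _) h1).trans
      (le_of_eq ?_)
    simp
  have hzeta : ∑ t ∈ Finset.range T, 1 / ((t + 1 : ℕ) : ℝ) ^ 2 ≤ Real.pi ^ 2 / 6 := by
    have h1 := sum_le_hasSum (Finset.range (T + 1)) (fun n _ => by positivity) hasSum_zeta_two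
    rw [Finset.sum_range_succ'] at h1
    simpa using h1
  have hsplit : regret μ P α β A T = ∑ t ∈ Finset.range T,
      (α * β * P.optValue P.mean - ∫ ω, P.reward (A (t + 1) ω) P.mean ∂μ) := by
    rw [regret, Finset.sum_sub_distrib, Finset.sum_const, Finset.card_range, nsmul_eq_mul,
      mul_comm (T : ℝ), Finset.range_eq_Ico,
      Finset.sum_Ico_add' (fun t => ∫ ω, P.reward (A t ω) P.mean ∂μ) 0 T 1]
    rfl
  rw [hsplit]
  refine (Finset.sum_le_sum fun t ht => h.round_regret_le hsmooth hα hβ horacle hγ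
    (Finset.mem_range.1 ht)).trans ?_
  rw [Finset.sum_add_distrib, ← Finset.mul_sum, ← Finset.mul_sum]
  have hint : ∑ t ∈ Finset.range T, ∫ ω, F t ω ∂μ = ∫ ω, ∑ t ∈ Finset.range T, F t ω ∂μ :=
    (integral_finsetSum _ hFint).symm
  change ∑ t ∈ Finset.range T, ∫ ω, F t ω ∂μ + _ ≤ _
  rw [hint]
  have h3 : ∑ t ∈ Finset.range T, 3 / ((t + 1 : ℕ) : ℝ) ^ 2 ≤ Real.pi ^ 2 / 2 := by
    have h4 : ∑ t ∈ Finset.range T, 3 / ((t + 1 : ℕ) : ℝ) ^ 2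
        = 3 * ∑ t ∈ Finset.range T, 1 / ((t + 1 : ℕ) : ℝ) ^ 2 := by
      rw [Finset.mul_sum]
      exact Finset.sum_congr rfl fun t _ => by ring
    rw [h4]
    linarith
  have h5 := mul_le_mul_of_nonneg_left h3 (by positivity : 0 ≤ G * (M * L))
  linarith

/-- Unless there is no arm, some batch is nonempty, so that `γinf` bounds a nonnegative number. -/
lemma gamma_nonneg [IsProbabilityMeasure μ] (h : IsBCUCBRun μ P oracle T X A) (hT : 1 ≤ T)
    (hL : 0 < L) (i : Fin M) (hsmooth : IsMonotonicGiniSmooth P.actions (P.rewardFn i) γinf γg) :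
    0 ≤ γinf := by
  obtain ⟨ω, hmem, hinit⟩ := ((h.batch_mem 0 hT).and (h.init_round 0 hT)).exists
  obtain ⟨j, -, hj⟩ := hinit ⟨⟨0, hL⟩, count_zero A ω _⟩
  have := hsmooth.deriv_mem _ hmem (fun _ => 1 / 2) (fun _ => by norm_num) j hj
  exact this.1.trans this.2

end IsBCUCBRun

/-! ### Numerical constants -/

lemma one_le_logFactor {K : ℕ} (hK : 2 ≤ K) : 1 ≤ logFactor K := by
  have h1 : 0 < Real.log K / 1.61 := div_pos (Real.log_pos (by exact_mod_cast hK)) (by norm_num)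
  unfold logFactor
  exact_mod_cast Int.one_le_ceil_iff.2 h1

/-- With l = ⌈log K / 1.61⌉ ≥ 1, √(1 + log K) ≤ √(1 + 1.61l) ≤ 1 + l, so the left side is at most
24(4 + l) ≤ 120l, against at least 184l on the right. -/
lemma constant_le {K : ℕ} (hK : 2 ≤ K) :
    24 * (3 + √(1 + Real.log K)) ≤ 2 * √8640 * logFactor K := by
  have h1 := one_le_logFactor hK
  have h2 : Real.log K ≤ 1.61 * logFactor K := by
    have := Int.le_ceil (Real.log K / 1.61)
    rw [div_le_iff₀ (by norm_num)] at this
    unfold logFactor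
    linarith
  have h3 : √(1 + Real.log K) ≤ 1 + logFactor K := by
    rw [Real.sqrt_le_left (by linarith)]
    nlinarith
  have h4 : (92 : ℝ) ≤ √8640 := Real.le_sqrt_of_sq_le (by norm_num)
  nlinarith

end CombBandit

theorem corollary2 {L M K T : ℕ} (P : CombBandit.Problem L M)
    (hK : 2 ≤ K) (hcard : ∀ A ∈ P.actions, A.card ≤ K) (hT : 1 ≤ T)
    (γinf γg : ℝ)
    (hsmooth : ∀ i, CombBandit.IsMonotonicGiniSmooth P.actions (P.rewardFn i) γinf γg)
    (α β : ℝ) (hα : 0 ≤ α ∧ α ≤ 1) (hβ : 0 ≤ β ∧ β ≤ 1)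
    (oracle : (Fin M → Fin L → ℝ) → PMF (Finset (Fin L)))
    (horacle : P.IsApproxOracle oracle α β)
    {Ω : Type*} [MeasurableSpace Ω] (μ : MeasureTheory.Measure Ω)
    [MeasureTheory.IsProbabilityMeasure μ]
    (X : ℕ → Ω → Fin M → Fin L → ℝ) (A : ℕ → Ω → Finset (Fin L))
    (hrun : CombBandit.IsBCUCBRun μ P oracle T X A) :
    CombBandit.regret μ P α β A T ≤
      2 * √8640 * γg * P.totalWeight * CombBandit.logFactor K * √(L * T * Real.log T)
      + L * P.maxGap α * (1 + M * (2 * Real.pi ^ 2 / 3))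
      + 340 * γinf * P.totalWeight * L * CombBandit.logFactor K ^ 2 * Real.log T *
          max 1 (2 + Real.log (P.maxGap α * T /
            (340 * γinf * P.totalWeight * L * CombBandit.logFactor K ^ 2 * Real.log T))) := by
  have hW := P.totalWeight_nonneg
  have hlog : 0 ≤ Real.log (T : ℝ) := Real.log_natCast_nonneg T
  have hγ : 0 ≤ γg * P.totalWeight := by
    rcases Nat.eq_zero_or_pos M with rfl | hM
    · simp [CombBandit.Problem.totalWeight]
    · exact mul_nonneg ((hsmooth ⟨0, hM⟩).gini_nonneg P.actions_nonempty) hW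
  have hγinf : 0 ≤ 340 * γinf * P.totalWeight * L * CombBandit.logFactor K ^ 2 * Real.log T := by
    rcases Nat.eq_zero_or_pos M with rfl | hM
    · simp [CombBandit.Problem.totalWeight]
    rcases Nat.eq_zero_or_pos L with rfl | hL
    · simp
    have := hrun.gamma_nonneg hT hL ⟨0, hM⟩ (hsmooth ⟨0, hM⟩)
    positivity
  -- The maximum is at least 1, so the last summand is nonnegative whatever the conventions for log
  -- 0 and division by 0, and it can be dropped.
  have hlast := mul_nonneg hγinf (zero_le_one.trans (le_max_left 1 (2 + Real.log (P.maxGap α * T /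
    (340 * γinf * P.totalWeight * L * CombBandit.logFactor K ^ 2 * Real.log T)))))
  have hmain := hrun.regret_le (by omega : 1 ≤ K) hT hcard hsmooth hα.1 hβ.2 horacle hγ
  have hfirst : 24 * (γg * P.totalWeight) * √(Real.log T)
        * ((3 + √(1 + Real.log K)) * √(L * T))
      ≤ 2 * √8640 * γg * P.totalWeight * CombBandit.logFactor K * √(L * T * Real.log T) := by
    rw [Real.sqrt_mul (by positivity : (0 : ℝ) ≤ L * T)]
    have := mul_le_mul_of_nonneg_left (CombBandit.constant_le hK)
      (by positivity : 0 ≤ γg * P.totalWeight * (√(L * T) * √(Real.log T)))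
    linarith
  have hsecond : L * P.maxGap α * (1 + M * (Real.pi ^ 2 / 2))
      ≤ L * P.maxGap α * (1 + M * (2 * Real.pi ^ 2 / 3)) := by
    have := P.maxGap_nonneg α
    gcongr ?_ * (1 + _ * ?_)
    nlinarith [sq_nonneg Real.pi]
  linarith
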